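/- Work over $\mathbb C$ with homogeneous coordinates $(x:y:z)$ on $\mathbb P^2$. Let $V^3$ be the space of differential forms $P\,dx+Q\,dy$ with $P,Q\in\mathbb C[x,y,z]$ homogeneous of degree $3$ (inhomogeneous formulas below are homogenised with $z$), and let $V^3_{\rm Poinc}\subset V^3$ be the affine subspace of Poincaré forms, i.e. those with $P=Q=0$, $P_x=Q_y=1$, $P_y=Q_x=0$ at $O=(0:0:1)$. A curve $F=0$ is an integral curve of $P\,dx+Q\,dy$ with cofactor $K$ if $PF_y-QF_x=-FK$; the form is Darboux integrable by means of integral curves $F_1,\dots,F_s$ with cofactors $K_1,\dots,K_s$ if $Q_x-P_y=\sum_i\alpha_iK_i$ for some $\alpha_i\in\mathbb C$. Let $X_{(2,1,1)}\subset V^3_{\rm Poinc}$ be the set of Poincaré forms having a smooth conic and two lines as integral curves, such that none of the three curves is tangent to (or equal to) the line at infinity $z=0$, no two are tangent to each other, no two meet on $z=0$, and the three have no common point. Bars denote Zariski closure in $V^3_{\rm Poinc}$. Let $X_\infty\subset V^3_{\rm Poinc}$ be the total center variety, i.e. the set of Poincaré forms all of whose focal values vanish (equivalently: there is a formal series $F=x^2+y^2+\cdots$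 with $F_xQ-F_yP=0$, where $P,Q$ are taken at $z=1$). For $t=(c,k,l,m,n,p,q,r)\in\mathbb C^8$ and $T=x+y+c$ let $\omega_t=P\,dx+Q\,dy$ with $$P=-\bigl(-ky^2+2(q-m)xy+2rxT-2ly^3-yqT-rT^2-2ny^2T-2pyT^2\bigr),$$ $$Q=2\bigl((m-k-q)xy-(m+r)xT+ly^3+(p-n)yT^2+(n-l)y^2T-pT^3\bigr).$$ Let $Y_{CR12}\subset V^3$ (Żołądek's family $CR_{12}$) be the set of all pull-backs $\varphi^*\omega_t$ under invertible affine changes of coordinates $\varphi$ of the plane, and $X_{CR12}=Y_{CR12}\cap V^3_{\rm Poinc}$. (1) For general $t$ (i.e. outside the zero set of some nonzero polynomial in the eight parameters) the linear system $$\begin{pmatrix}0&-c&0&0&1&0\\-2pc-m-r&\tfrac12r&0&p&0&0\\-2nc-k+2m-q+r&-m+\tfrac12q-r&r&n&0&0\\-2lc+k-m+q&-\tfrac12k+m-q&-m+q&l&0&0\\-c^2&0&0&0&0&1\end{pmatrix}\begin{pmatrix}a_{20}\\a_{11}\\a_{02}\\a_{10}\\a_{01}\\a_{00}\end{pmatrix}=0$$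 has a nonzero solution, unique up to scaling, and $a_{20}x^2+a_{11}xy+a_{02}y^2+a_{10}x+a_{01}y+a_{00}=0$ is a smooth conic which is an integral curve of $\omega_t$. Moreover $ky^2+qTy+rT^2=0$ is a pair of distinct lines that are integral curves of $\omega_t$, and $\omega_t$ is Darboux integrable by means of this conic and these two lines. (2) $X_{CR12}\cap X_\infty\subset\overline{X_{(2,1,1)}}$. (3) Every Poincaré form $\varphi^*\omega_t$ for which $\varphi(O)$ is not the point $y=T=0$ lies in $\overline{X_{(2,1,1)}}$ (whether or not its focal values are assumed to vanish). -/

import Mathlib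

noncomputable section

namespace PlaneForm

/-- The coordinate ring `ℂ[x,y,z]` of the projective plane. -/
abbrev Poly : Type := MvPolynomial (Fin 3) ℂ

/-- The coordinates `x`, `y`, `z`; the line at infinity is `z = 0`. -/
abbrev x : Poly := MvPolynomial.X 0
abbrev y : Poly := MvPolynomial.X 1
abbrev z : Poly := MvPolynomial.X 2

/-- A polynomial differential form `P dx + Q dy`. -/
@[ext] structure DiffForm where
  P : Poly
  Q : Poly

/-- The space `V^d` of differential forms whose coefficients are homogeneous of degree `d`. -/
def V (d : ℕ) : Set DiffForm :=
  {ω | ω.P.IsHomogeneous d ∧ ω.Q.IsHomogeneous d}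

/-- The origin `(0:0:1)` of the affine plane `z ≠ 0`. -/
def origin : Fin 3 → ℂ := ![0, 0, 1]

/-- The Poincaré differential forms of degree `d`. -/
def poincare (d : ℕ) : Set DiffForm :=
  {ω | ω ∈ V d ∧
    MvPolynomial.eval origin ω.P = 0 ∧ MvPolynomial.eval origin ω.Q = 0 ∧
    MvPolynomial.eval origin (MvPolynomial.pderiv 0 ω.P) = 1 ∧
    MvPolynomial.eval origin (MvPolynomial.pderiv 1 ω.Q) = 1 ∧
    MvPolynomial.eval origin (MvPolynomial.pderiv 1 ω.P) = 0 ∧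
    MvPolynomial.eval origin (MvPolynomial.pderiv 0 ω.Q) = 0}

/-! ### Focal values -/

/-- `G(x,y,1)` as a formal power series in `x`, `y`. -/
def dehom (G : Poly) : MvPowerSeries (Fin 2) ℂ :=
  ((MvPolynomial.aeval ![MvPolynomial.X 0, MvPolynomial.X 1, 1] G : MvPolynomial (Fin 2) ℂ) :
    MvPowerSeries (Fin 2) ℂ)

/-- The formal series `F` starts with `x² + y²`: below degree three it agrees with `x² + y²`. -/
def StartsWithCircle (F : MvPowerSeries (Fin 2) ℂ) : Prop :=
  ∀ e : Fin 2 →₀ ℕ, e 0 + e 1 < 3 →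
    MvPowerSeries.coeff e F =
      MvPolynomial.coeff e (MvPolynomial.X 0 ^ 2 + MvPolynomial.X 1 ^ 2 : MvPolynomial (Fin 2) ℂ)

/-- The total center variety `X_∞` in degree `d`: the Poincaré forms all of whose focal values
vanish, i.e. for which some formal `F = x² + y² + …` satisfies `F_x Q - F_y P = 0`. -/
def centerVariety (d : ℕ) : Set DiffForm :=
  {ω | ω ∈ poincare d ∧ ∃ F : MvPowerSeries (Fin 2) ℂ, StartsWithCircle F ∧
    MvPowerSeries.pderiv ℂ 0 F * dehom ω.Q - MvPowerSeries.pderiv ℂ 1 F * dehom ω.P = 0}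

/-! ### Integral curves and Darboux integrability -/

/-- `K` is the cofactor of the curve `F = 0`: `P F_y - Q F_x = - F K`.
(For homogeneous `F ≠ 0` and a form of degree `d`, `K` is homogeneous of degree `d - 1`.) -/
def IsCofactor (ω : DiffForm) (F K : Poly) : Prop :=
  ω.P * MvPolynomial.pderiv 1 F - ω.Q * MvPolynomial.pderiv 0 F = -(F * K)

/-- `F` is the equation of a projective plane curve of degree `e`. -/
def IsCurve (e : ℕ) (F : Poly) : Prop :=
  0 < e ∧ F ≠ 0 ∧ F.IsHomogeneous e

/-- The curve `F = 0` is an integral curve of the form. -/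
def IsIntegralCurve (ω : DiffForm) (F : Poly) : Prop :=
  (∃ e, IsCurve e F) ∧ ∃ K, IsCofactor ω F K

/-- The form is Darboux integrable by means of the integral curves `F i = 0`: a linear combination
of their cofactors is `Q_x - P_y` (so that a product of powers of the `F i` is an integrating
factor). -/
def DarbouxIntegrableWith {n : ℕ} (ω : DiffForm) (F : Fin n → Poly) : Prop :=
  (∀ i, IsIntegralCurve ω (F i)) ∧
  ∃ (K : Fin n → Poly) (α : Fin n → ℂ), (∀ i, IsCofactor ω (F i) (K i)) ∧
    MvPolynomial.pderiv 0 ω.Q - MvPolynomial.pderiv 1 ω.P = ∑ i, MvPolynomial.C (α i) * K i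

/-! ### Curves in general position -/

/-- The gradient `(F_x, F_y, F_z)` at a point. -/
def grad (F : Poly) (v : Fin 3 → ℂ) : Fin 3 → ℂ :=
  fun j => MvPolynomial.eval v (MvPolynomial.pderiv j F)

/-- The projective curve `F = 0` is smooth. -/
def IsSmoothCurve (F : Poly) : Prop :=
  ∀ v : Fin 3 → ℂ, v ≠ 0 → MvPolynomial.eval v F = 0 → grad F v ≠ 0

/-- The curves `F = 0` and `G = 0` are nowhere tangent in the projective plane. -/
def NowhereTangent (F G : Poly) : Prop :=
  ∀ v : Fin 3 → ℂ, v ≠ 0 → MvPolynomial.eval v F = 0 → MvPolynomial.eval v G = 0 →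
    LinearIndependent ℂ ![grad F v, grad G v]

/-- Smooth curves `F i = 0` of degrees `deg i`, none tangent to the line at infinity, no two
tangent to each other, no two meeting at infinity, no three through one point. -/
structure GeneralPosition {n : ℕ} (deg : Fin n → ℕ) (F : Fin n → Poly) : Prop where
  curve : ∀ i, IsCurve (deg i) (F i)
  smooth : ∀ i, IsSmoothCurve (F i)
  infinity : ∀ i, NowhereTangent (F i) z
  tangent : ∀ i j, i ≠ j → NowhereTangent (F i) (F j)
  meet_infinity : ∀ i j, i ≠ j → ∀ v : Fin 3 → ℂ, v ≠ 0 → v 2 = 0 →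
    ¬ (MvPolynomial.eval v (F i) = 0 ∧ MvPolynomial.eval v (F j) = 0)
  three : ∀ i j k, i ≠ j → j ≠ k → i ≠ k → ∀ v : Fin 3 → ℂ, v ≠ 0 →
    ¬ (MvPolynomial.eval v (F i) = 0 ∧ MvPolynomial.eval v (F j) = 0 ∧
      MvPolynomial.eval v (F k) = 0)

/-- `Y_deg`: forms of degree `d`, `∑ deg i = d + 1`, with integral curves of degrees `deg i` in
general position. -/
def YDarboux (d : ℕ) {n : ℕ} (deg : Fin n → ℕ) : Set DiffForm :=
  {ω | ω ∈ V d ∧ ∑ i, deg i = d + 1 ∧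
    ∃ F : Fin n → Poly, GeneralPosition deg F ∧ ∀ i, IsIntegralCurve ω (F i)}

/-- `X_deg`: the Poincaré forms in `Y_deg`. -/
def XDarboux (d : ℕ) {n : ℕ} (deg : Fin n → ℕ) : Set DiffForm :=
  YDarboux d deg ∩ poincare d

/-! ### Zariski closure -/

/-- The coefficients `p_{ij}`, `q_{ij}` of a form, as a point of an affine space. -/
def coords (ω : DiffForm) : Fin 2 × (Fin 3 →₀ ℕ) → ℂ :=
  fun s => if s.1 = 0 then MvPolynomial.coeff s.2 ω.P else MvPolynomial.coeff s.2 ω.Q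

/-- The Zariski closure of a set of forms inside the affine space of Poincaré forms of
degree `d`. -/
def zariskiClosure (d : ℕ) (S : Set DiffForm) : Set DiffForm :=
  {ω | ω ∈ poincare d ∧
    coords ω ∈ MvPolynomial.zeroLocus ℂ (MvPolynomial.vanishingIdeal ℂ (coords '' S))}

/-! ### Affine changes of coordinates -/

/-- An affine change of coordinates of the plane, `v ↦ lin v + tr` with `lin` invertible. -/
structure AffineChange where
  lin : Matrix (Fin 2) (Fin 2) ℂ
  tr : Fin 2 → ℂ
  det_ne_zero : lin.det ≠ 0

/-- The homogenised components of an affine change of coordinates. -/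
def AffineChange.comp (φ : AffineChange) : Fin 3 → Poly :=
  ![MvPolynomial.C (φ.lin 0 0) * x + MvPolynomial.C (φ.lin 0 1) * y + MvPolynomial.C (φ.tr 0) * z,
    MvPolynomial.C (φ.lin 1 0) * x + MvPolynomial.C (φ.lin 1 1) * y + MvPolynomial.C (φ.tr 1) * z,
    z]

/-- The pull-back `φ^*(P dx + Q dy)`. -/
def AffineChange.pullback (φ : AffineChange) (ω : DiffForm) : DiffForm where
  P := MvPolynomial.C (φ.lin 0 0) * MvPolynomial.aeval φ.comp ω.P +
    MvPolynomial.C (φ.lin 1 0) * MvPolynomial.aeval φ.comp ω.Q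
  Q := MvPolynomial.C (φ.lin 0 1) * MvPolynomial.aeval φ.comp ω.P +
    MvPolynomial.C (φ.lin 1 1) * MvPolynomial.aeval φ.comp ω.Q

/-! ### The family `CR₁₂` -/

/-- The parameters of the family `CR₁₂`. -/
structure Param where
  c : ℂ
  k : ℂ
  l : ℂ
  m : ℂ
  n : ℂ
  p : ℂ
  q : ℂ
  r : ℂ

/-- The parameters as a point of affine 8-space. -/
def Param.toFun (t : Param) : Fin 8 → ℂ := ![t.c, t.k, t.l, t.m, t.n, t.p, t.q, t.r]

/-- `T = x + y + c`, homogenised. -/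
def Param.T (t : Param) : Poly := x + y + MvPolynomial.C t.c * z

open MvPolynomial in
/-- The differential form of the family `CR₁₂` with the given parameters, homogenised. -/
def Param.form (t : Param) : DiffForm where
  P := -(-(C t.k * y ^ 2 * z) + 2 * (C t.q - C t.m) * x * y * z + 2 * C t.r * x * t.T * z
    - 2 * C t.l * y ^ 3 - C t.q * y * t.T * z - C t.r * t.T ^ 2 * z
    - 2 * C t.n * y ^ 2 * t.T - 2 * C t.p * y * t.T ^ 2)
  Q := 2 * ((C t.m - C t.k - C t.q) * x * y * z - (C t.m + C t.r) * x * t.T * z + C t.l * y ^ 3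
    + (C t.p - C t.n) * y * t.T ^ 2 + (C t.n - C t.l) * y ^ 2 * t.T - C t.p * t.T ^ 3)

/-- The `5 × 6` matrix whose kernel gives the coefficients
`(a₂₀, a₁₁, a₀₂, a₁₀, a₀₁, a₀₀)` of the conic. -/
def Param.conicMatrix (t : Param) : Matrix (Fin 5) (Fin 6) ℂ :=
  !![0, -t.c, 0, 0, 1, 0;
    -2 * t.p * t.c - t.m - t.r, t.r / 2, 0, t.p, 0, 0;
    -2 * t.n * t.c - t.k + 2 * t.m - t.q + t.r, -t.m + t.q / 2 - t.r, t.r, t.n, 0, 0;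
    -2 * t.l * t.c + t.k - t.m + t.q, -t.k / 2 + t.m - t.q, -t.m + t.q, t.l, 0, 0;
    -t.c ^ 2, 0, 0, 0, 0, 1]

open MvPolynomial in
/-- The conic `a₂₀x² + a₁₁xy + a₀₂y² + a₁₀x + a₀₁y + a₀₀`, homogenised. -/
def conic (a : Fin 6 → ℂ) : Poly :=
  C (a 0) * x ^ 2 + C (a 1) * x * y + C (a 2) * y ^ 2 + C (a 3) * x * z + C (a 4) * y * z
    + C (a 5) * z ^ 2

open MvPolynomial in
/-- The equation `k y² + q T y + r T²` of the pair of lines. -/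
def Param.linePair (t : Param) : Poly :=
  C t.k * y ^ 2 + C t.q * t.T * y + C t.r * t.T ^ 2

/-- The forms that an affine change of coordinates brings into the normal form of `CR₁₂`
(a constant factor is absorbed by the parameters `k, …, r`). -/
def YCR12 : Set DiffForm := {ω | ∃ (t : Param) (φ : AffineChange), ω = φ.pullback t.form}

/-- The Poincaré differential forms in the family `CR₁₂`. -/
def XCR12 : Set DiffForm := YCR12 ∩ poincare 3

end PlaneForm

end

/-!
With `S = ky² + qyT + rT²` and `g = ly² + nyT + pT²`, a member of the family `CR₁₂` is
`S dx - x dS + 2(g + (m - q/2)x)(y dT - T dy)`. Pulling back by an affine map keeps this shape: one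
gets a *radial form* `S dℓ - ℓ dS + 2(g + dℓ)(X dY - Y dX)`, with `ℓ` affine and `S`, `g` binary
quadratic forms in linear coordinates `X`, `Y` centred at the preimage `(a, b)` of the point
`y = T = 0` (`exists_radial_of_pullback`).

Write `S = LM` as a product of lines. For a binary quadratic form `h` in `X`, `Y`, Euler's identity
turns `S dh - h dS` into a multiple of `X dY - Y dX`, and `L dM - M dL` is one as well. Hence the
logarithmic form `S dF - F dS + kF(L dM - M dL)` along the conic `F = h + ℓ` and the lines `L`, `M`
is radial, with `g` depending linearly on `h` (`Radial.form_ofLog`). Conversely, a radial form with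
distinct lines is logarithmic as soon as the linear equation for `h` can be solved. A logarithmic
form along three curves is Darboux integrable by means of them (`darbouxIntegrableWith_logForm`).

For the first assertion, the linear equation for `h` is the block of rows two to four of the given
system. For general parameters it is solved by Cramer's rule, so that the system has a kernel of
dimension one, and the conic it gives is smooth (`Param.exists_conic_and_lines`).

For the other two, a Zariski closure contains the limits of its members, since polynomials are
continuous (`mem_zariskiClosure_of_eventually`). So it suffices to approximate the form by Poincaré
forms that are logarithmic along a conic and two lines in general position. The conditions for
being a Poincaré form are solved explicitly, according to the position of the origin.

* If the origin is on neither of the lines, the conditions determine `ℓ` and two of the three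
  coefficients of `g`; the rest is free, and general values of the free data give a logarithmic form
  along curves in general position (`Radial.offLines_mem_closure`).
* If the origin is on just one of the lines, this line is isotropic, the residues are `1, 1, -3`,
  and the form is logarithmic along a conic whose coefficients are free up to what the origin
  imposes (`Radial.onLine_mem_closure`).
* If both lines pass through the origin, then `S` is a multiple of `x² + y²` and `d = 0`. Now
  `h ↦ S dh - h dS` has rank two, and its image consists of the `g` apolar to `x² + y²`. The first
  focal value of the form is this apolarity (`Radial.apolar_of_mem_centerVariety`), and where it
  vanishes the conic may be changed by multiples of `S`, which brings it into general position
  (`Radial.mem_closure_of_node`). This is the only place where the centre condition is used.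
-/

noncomputable section

namespace PlaneForm

open MvPolynomial Filter Topology

/-! ### Zariski closure and limits -/

theorem subset_zariskiClosure {d : ℕ} {S : Set DiffForm} (hS : S ⊆ poincare d) :
    S ⊆ zariskiClosure d S :=
  fun ω hω => ⟨hS hω, fun _ hp => hp _ ⟨ω, hω, rfl⟩⟩

/-- Polynomials are continuous, so the Zariski closure contains the limits of its members. -/
theorem mem_zariskiClosure_of_eventually {d : ℕ} {S : Set DiffForm} {ω : ℂ → DiffForm} {t₀ : ℂ}
    (hc : ∀ s, Continuous fun t => coords (ω t) s) (h₀ : ω t₀ ∈ poincare d)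
    (h : ∀ᶠ t in 𝓝[≠] t₀, ω t ∈ zariskiClosure d S) : ω t₀ ∈ zariskiClosure d S := by
  refine ⟨h₀, fun p hp => ?_⟩
  have hcont : Continuous fun t => aeval (coords (ω t)) p :=
    (MvPolynomial.continuous_eval p).comp (continuous_pi hc)
  have h1 : Tendsto (fun t => aeval (coords (ω t)) p) (𝓝[≠] t₀)
      (𝓝 (aeval (coords (ω t₀)) p)) := hcont.continuousAt.tendsto.mono_left nhdsWithin_le_nhds
  have h2 : Tendsto (fun t => aeval (coords (ω t)) p) (𝓝[≠] t₀) (𝓝 0) :=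
    tendsto_const_nhds.congr' (by filter_upwards [h] with t ht using (ht.2 p hp).symm)
  exact tendsto_nhds_unique h1 h2

/-- An entire function that does not vanish identically has isolated zeros. -/
theorem eventually_ne_zero {f : ℂ → ℂ} (hf : Differentiable ℂ f) (t₁ : ℂ) (h : f t₁ ≠ 0) (t₀ : ℂ) :
    ∀ᶠ t in 𝓝[≠] t₀, f t ≠ 0 := by
  have hA : AnalyticOnNhd ℂ f Set.univ := hf.differentiableOn.analyticOnNhd isOpen_univ
  rcases (hA t₀ trivial).eventually_eq_zero_or_eventually_ne_zero with h0 | h0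
  · exact absurd (hA.eqOn_zero_of_preconnected_of_eventuallyEq_zero isPreconnected_univ
      (Set.mem_univ t₀) h0 (Set.mem_univ t₁)) h
  · exact h0

/-- All coefficients of a polynomial depend continuously on a parameter. -/
def CoeffContinuous {σ : Type*} (f : ℂ → MvPolynomial σ ℂ) : Prop :=
  ∀ s, Continuous fun t => coeff s (f t)

namespace CoeffContinuous

variable {σ : Type*} {f g : ℂ → MvPolynomial σ ℂ}

theorem const (p : MvPolynomial σ ℂ) : CoeffContinuous fun _ => p := fun _ => continuous_const

theorem ofC {c : ℂ → ℂ} (hc : Continuous c) :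
    CoeffContinuous fun t => (C (c t) : MvPolynomial σ ℂ) := by
  classical
  intro s
  simp only [coeff_C]
  split_ifs
  · exact hc
  · exact continuous_const

theorem add (hf : CoeffContinuous f) (hg : CoeffContinuous g) :
    CoeffContinuous fun t => f t + g t := fun s => by
  simp only [coeff_add]
  exact (hf s).add (hg s)

theorem sub (hf : CoeffContinuous f) (hg : CoeffContinuous g) :
    CoeffContinuous fun t => f t - g t := fun s => by
  simp only [coeff_sub]
  exact (hf s).sub (hg s)

theorem mul (hf : CoeffContinuous f) (hg : CoeffContinuous g) :
    CoeffContinuous fun t => f t * g t := fun s => by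
  classical
  simp only [coeff_mul]
  exact continuous_finsetSum _ fun i _ => (hf _).mul (hg _)

end CoeffContinuous

/-! ### Logarithmic forms -/

theorem pderiv_comm {σ : Type*} (i j : σ) (F : MvPolynomial σ ℂ) :
    pderiv i (pderiv j F) = pderiv j (pderiv i F) := by
  classical
  ext m
  simp only [coeff_pderiv, Finsupp.add_apply, Finsupp.single_apply]
  by_cases h : i = j
  · subst h; rfl
  · rw [add_right_comm]
    simp [h, Ne.symm h]
    ring

/-- The form `F₁F₂F₃ ∑ αᵢ dFᵢ / Fᵢ`. -/
def logForm (α₁ α₂ α₃ : ℂ) (F₁ F₂ F₃ : Poly) : DiffForm where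
  P := C α₁ * F₂ * F₃ * pderiv 0 F₁ + C α₂ * F₁ * F₃ * pderiv 0 F₂ + C α₃ * F₁ * F₂ * pderiv 0 F₃
  Q := C α₁ * F₂ * F₃ * pderiv 1 F₁ + C α₂ * F₁ * F₃ * pderiv 1 F₂ + C α₃ * F₁ * F₂ * pderiv 1 F₃

/-- The coefficient of `dx ∧ dy` in `dF ∧ dG`. -/
def wedge (F G : Poly) : Poly := pderiv 0 F * pderiv 1 G - pderiv 1 F * pderiv 0 G

section

variable (α₁ α₂ α₃ : ℂ) (F₁ F₂ F₃ : Poly)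

theorem isCofactor_logForm₁ : IsCofactor (logForm α₁ α₂ α₃ F₁ F₂ F₃) F₁
    (C α₂ * F₃ * wedge F₁ F₂ + C α₃ * F₂ * wedge F₁ F₃) := by
  simp only [IsCofactor, logForm, wedge]; ring

theorem isCofactor_logForm₂ : IsCofactor (logForm α₁ α₂ α₃ F₁ F₂ F₃) F₂
    (C α₁ * F₃ * wedge F₂ F₁ + C α₃ * F₁ * wedge F₂ F₃) := by
  simp only [IsCofactor, logForm, wedge]; ring

theorem isCofactor_logForm₃ : IsCofactor (logForm α₁ α₂ α₃ F₁ F₂ F₃) F₃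
    (C α₁ * F₂ * wedge F₃ F₁ + C α₂ * F₁ * wedge F₃ F₂) := by
  simp only [IsCofactor, logForm, wedge]; ring

/-- `F₁F₂F₃` is an inverse integrating factor of the logarithmic form, so the cofactors add up to
`Q_x - P_y`. -/
theorem darbouxIntegrableWith_logForm {e₁ e₂ e₃ : ℕ} (h₁ : IsCurve e₁ F₁) (h₂ : IsCurve e₂ F₂)
    (h₃ : IsCurve e₃ F₃) :
    DarbouxIntegrableWith (logForm α₁ α₂ α₃ F₁ F₂ F₃) ![F₁, F₂, F₃] := by
  refine ⟨fun i => ?_, ![C α₂ * F₃ * wedge F₁ F₂ + C α₃ * F₂ * wedge F₁ F₃,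
    C α₁ * F₃ * wedge F₂ F₁ + C α₃ * F₁ * wedge F₂ F₃,
    C α₁ * F₂ * wedge F₃ F₁ + C α₂ * F₁ * wedge F₃ F₂], ![1, 1, 1], fun i => ?_, ?_⟩
  · fin_cases i
    · exact ⟨⟨_, h₁⟩, _, isCofactor_logForm₁ ..⟩
    · exact ⟨⟨_, h₂⟩, _, isCofactor_logForm₂ ..⟩
    · exact ⟨⟨_, h₃⟩, _, isCofactor_logForm₃ ..⟩
  · fin_cases i
    · exact isCofactor_logForm₁ ..
    · exact isCofactor_logForm₂ ..
    · exact isCofactor_logForm₃ ..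
  · simp only [logForm, wedge, Fin.sum_univ_three, map_add, Derivation.leibniz, smul_eq_mul,
      pderiv_C, Matrix.cons_val_zero, Matrix.cons_val_one, Matrix.cons_val]
    rw [pderiv_comm 0 1 F₁, pderiv_comm 0 1 F₂, pderiv_comm 0 1 F₃, map_one]
    ring

end

/-! ### Conics and lines in general position -/

/-- The linear form `u x + v y + w z`. -/
def line (u v w : ℂ) : Poly := C u * x + C v * y + C w * z

/-- The equation `h₁L² + h₂LM + h₃M² + e₁L + e₂M - c`, homogenised. If `L`, `M`, `z` are independent
linear forms, every conic has an equation of this shape. -/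
def lineConic (L M : Poly) (h₁ h₂ h₃ e₁ e₂ c : ℂ) : Poly :=
  C h₁ * L ^ 2 + C h₂ * L * M + C h₃ * M ^ 2 + (C e₁ * L + C e₂ * M) * z - C c * z ^ 2

theorem isHomogeneous_line (u v w : ℂ) : (line u v w).IsHomogeneous 1 := by
  have h (a : ℂ) (i : Fin 3) : (C a * X i : Poly).IsHomogeneous 1 := by
    simpa using (isHomogeneous_C (Fin 3) a).mul (isHomogeneous_X ℂ i)
  exact ((h u 0).add (h v 1)).add (h w 2)

theorem isHomogeneous_lineConic {L M : Poly} (hL : L.IsHomogeneous 1) (hM : M.IsHomogeneous 1)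
    (h₁ h₂ h₃ e₁ e₂ c : ℂ) : (lineConic L M h₁ h₂ h₃ e₁ e₂ c).IsHomogeneous 2 := by
  have hC (a : ℂ) := isHomogeneous_C (Fin 3) a
  have hz : z.IsHomogeneous 1 := isHomogeneous_X ℂ 2
  have h2 {F G : Poly} (a : ℂ) (hF : F.IsHomogeneous 1) (hG : G.IsHomogeneous 1) :
      (C a * F * G).IsHomogeneous 2 := by simpa using ((hC a).mul hF).mul hG
  have e : lineConic L M h₁ h₂ h₃ e₁ e₂ c = C h₁ * L * L + C h₂ * L * M + C h₃ * M * M +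
      C e₁ * L * z + C e₂ * M * z - C c * z * z := by rw [lineConic]; ring
  rw [e]
  exact (((((h2 h₁ hL hL).add (h2 h₂ hL hM)).add (h2 h₃ hM hM)).add (h2 e₁ hL hz)).add
    (h2 e₂ hM hz)).sub (h2 c hz hz)

section

variable {u₁ v₁ w₁ u₂ v₂ w₂ h₁ h₂ h₃ e₁ e₂ c : ℂ}

theorem eval_line (v : Fin 3 → ℂ) : eval v (line u₁ v₁ w₁) = u₁ * v 0 + v₁ * v 1 + w₁ * v 2 := by
  simp [line]

theorem grad_line (v : Fin 3 → ℂ) : grad (line u₁ v₁ w₁) v = ![u₁, v₁, w₁] := by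
  ext j; fin_cases j <;> simp [line, grad, pderiv_X, Derivation.leibniz]

theorem grad_z (v : Fin 3 → ℂ) : grad z v = ![0, 0, 1] := by
  ext j; fin_cases j <;> simp [grad, pderiv_X]

/-- A point is determined by the values of `L`, `M`, `z`. -/
theorem eq_zero_of_lines (hd : u₁ * v₂ - u₂ * v₁ ≠ 0) {v : Fin 3 → ℂ}
    (hL : eval v (line u₁ v₁ w₁) = 0) (hM : eval v (line u₂ v₂ w₂) = 0) (hz : v 2 = 0) : v = 0 := by
  rw [eval_line, hz] at hL hM
  have h0 : v 0 = 0 := by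
    apply (mul_eq_zero.1 (?_ : (u₁ * v₂ - u₂ * v₁) * v 0 = 0)).resolve_left hd
    linear_combination v₂ * hL - v₁ * hM
  have h1 : v 1 = 0 := by
    apply (mul_eq_zero.1 (?_ : (u₁ * v₂ - u₂ * v₁) * v 1 = 0)).resolve_left hd
    linear_combination u₁ * hM - u₂ * hL
  ext j; fin_cases j <;> simp [h0, h1, hz]

theorem eval_lineConic (L M : Poly) (v : Fin 3 → ℂ) : eval v (lineConic L M h₁ h₂ h₃ e₁ e₂ c) =
    h₁ * eval v L ^ 2 + h₂ * eval v L * eval v M + h₃ * eval v M ^ 2 +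
      (e₁ * eval v L + e₂ * eval v M) * v 2 - c * v 2 ^ 2 := by
  simp [lineConic]

theorem grad_lineConic (L M : Poly) (v : Fin 3 → ℂ) (j : Fin 3) :
    grad (lineConic L M h₁ h₂ h₃ e₁ e₂ c) v j =
      (2 * h₁ * eval v L + h₂ * eval v M + e₁ * v 2) * grad L v j +
      (h₂ * eval v L + 2 * h₃ * eval v M + e₂ * v 2) * grad M v j +
      (e₁ * eval v L + e₂ * eval v M - 2 * c * v 2) * grad z v j := by
  simp only [lineConic, grad, map_add, map_sub, Derivation.leibniz, Derivation.leibniz_pow,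
    pderiv_C, smul_eq_mul, map_mul, map_pow, eval_C, eval_X, map_zero, nsmul_eq_mul, map_natCast]
  push_cast
  ring

/-- The gradients of `L`, `M`, `z` are independent. -/
theorem coeff_eq_zero_of_lines (hd : u₁ * v₂ - u₂ * v₁ ≠ 0) {v : Fin 3 → ℂ} {a b d : ℂ}
    (h : ∀ j, a * grad (line u₁ v₁ w₁) v j + b * grad (line u₂ v₂ w₂) v j + d * grad z v j = 0) :
    a = 0 ∧ b = 0 ∧ d = 0 := by
  have h0 := h 0
  have h1 := h 1
  have h2 := h 2
  simp only [grad_line, grad_z, Matrix.cons_val_zero, Matrix.cons_val_one, Matrix.cons_val]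
    at h0 h1 h2
  have ha : a = 0 := by
    apply (mul_eq_zero.1 (?_ : (u₁ * v₂ - u₂ * v₁) * a = 0)).resolve_left hd
    linear_combination v₂ * h0 - u₂ * h1
  have hb : b = 0 := by
    apply (mul_eq_zero.1 (?_ : (u₁ * v₂ - u₂ * v₁) * b = 0)).resolve_left hd
    linear_combination u₁ * h1 - v₁ * h0
  subst ha hb
  exact ⟨rfl, rfl, by simpa using h2⟩

theorem isCurve_line (h : u₁ * v₂ - u₂ * v₁ ≠ 0) : IsCurve 1 (line u₁ v₁ w₁) := by
  refine ⟨one_pos, fun h0 => h ?_, isHomogeneous_line ..⟩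
  have e := grad_line (u₁ := u₁) (v₁ := v₁) (w₁ := w₁) 0
  have e0 := congrFun e 0
  have e1 := congrFun e 1
  simp only [h0, grad, map_zero, Matrix.cons_val_zero, Matrix.cons_val_one] at e0 e1
  rw [← e0, ← e1]; ring

/-- Completing the square in `z` shows that the conic is smooth when `c ≠ 0` and the binary form
`4ch + e²` has distinct roots. -/
theorem isSmoothCurve_lineConic (hd : u₁ * v₂ - u₂ * v₁ ≠ 0) (hc : c ≠ 0)
    (hk : (4 * c * h₂ + 2 * e₁ * e₂) ^ 2 - 4 * (4 * c * h₁ + e₁ ^ 2) * (4 * c * h₃ + e₂ ^ 2) ≠ 0) :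
    IsSmoothCurve (lineConic (line u₁ v₁ w₁) (line u₂ v₂ w₂) h₁ h₂ h₃ e₁ e₂ c) := by
  intro v hv _ hg
  obtain ⟨hX, hY, hZ⟩ := coeff_eq_zero_of_lines hd (v := v) fun j => by
    rw [← grad_lineConic, hg]; rfl
  set X := eval v (line u₁ v₁ w₁) with hX'
  set Y := eval v (line u₂ v₂ w₂) with hY'
  have hX0 : X = 0 := by
    apply (mul_eq_zero.1 (?_ : ((4 * c * h₂ + 2 * e₁ * e₂) ^ 2 -
      4 * (4 * c * h₁ + e₁ ^ 2) * (4 * c * h₃ + e₂ ^ 2)) * X = 0)).resolve_left hk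
    linear_combination (-2 * (4 * c * h₃ + e₂ ^ 2)) * (2 * (2 * c * hX + e₁ * hZ)) +
      (4 * c * h₂ + 2 * e₁ * e₂) * (2 * (2 * c * hY + e₂ * hZ))
  have hY0 : Y = 0 := by
    apply (mul_eq_zero.1 (?_ : ((4 * c * h₂ + 2 * e₁ * e₂) ^ 2 -
      4 * (4 * c * h₁ + e₁ ^ 2) * (4 * c * h₃ + e₂ ^ 2)) * Y = 0)).resolve_left hk
    linear_combination (-2 * (4 * c * h₁ + e₁ ^ 2)) * (2 * (2 * c * hY + e₂ * hZ)) +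
      (4 * c * h₂ + 2 * e₁ * e₂) * (2 * (2 * c * hX + e₁ * hZ))
  have hZ0 : v 2 = 0 := by
    simpa [hX0, hY0, hc] using hZ
  exact hv (eq_zero_of_lines hd hX0 hY0 hZ0)

theorem NowhereTangent.symm {F G : Poly} (h : NowhereTangent F G) : NowhereTangent G F := by
  intro v hv hG hF
  have := h v hv hF hG
  rw [LinearIndependent.pair_iff] at this ⊢
  exact fun s t hst => (this t s (by rw [add_comm]; exact hst)).symm

/-- The conic and the two lines `L = 0`, `M = 0` are in general position: in the order of the
fields, the three curves have no common point, the conic does not meet `M = 0` at infinity, does not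
meet `L = 0` at infinity, is not tangent to `z = 0`, to `M = 0`, to `L = 0`, and is smooth. -/
structure GenericConic (h₁ h₂ h₃ e₁ e₂ c : ℂ) : Prop where
  c_ne : c ≠ 0
  h₁_ne : h₁ ≠ 0
  h₃_ne : h₃ ≠ 0
  disc_ne : h₂ ^ 2 - 4 * h₁ * h₃ ≠ 0
  tangent₁_ne : 4 * c * h₁ + e₁ ^ 2 ≠ 0
  tangent₃_ne : 4 * c * h₃ + e₂ ^ 2 ≠ 0
  smooth_ne :
    (4 * c * h₂ + 2 * e₁ * e₂) ^ 2 - 4 * (4 * c * h₁ + e₁ ^ 2) * (4 * c * h₃ + e₂ ^ 2) ≠ 0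

theorem nowhereTangent_lineConic_z (hd : u₁ * v₂ - u₂ * v₁ ≠ 0)
    (hdisc : h₂ ^ 2 - 4 * h₁ * h₃ ≠ 0) :
    NowhereTangent (lineConic (line u₁ v₁ w₁) (line u₂ v₂ w₂) h₁ h₂ h₃ e₁ e₂ c) z := by
  intro v hv _ hz
  have hz : v 2 = 0 := by simpa using hz
  rw [LinearIndependent.pair_iff]
  intro s t hst
  obtain ⟨hX, hY, hZ⟩ := coeff_eq_zero_of_lines hd (v := v) (w₁ := w₁) (w₂ := w₂)
    (a := s * (2 * h₁ * eval v (line u₁ v₁ w₁) + h₂ * eval v (line u₂ v₂ w₂) + e₁ * v 2))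
    (b := s * (h₂ * eval v (line u₁ v₁ w₁) + 2 * h₃ * eval v (line u₂ v₂ w₂) + e₂ * v 2))
    (d := s * (e₁ * eval v (line u₁ v₁ w₁) + e₂ * eval v (line u₂ v₂ w₂) - 2 * c * v 2) + t)
    fun j => by
      have := congrFun hst j
      simp only [Pi.add_apply, Pi.smul_apply, smul_eq_mul, grad_lineConic, Pi.zero_apply] at this
      linear_combination this
  have hs : s = 0 := by
    by_contra hs
    have hX := (mul_eq_zero.1 hX).resolve_left hs
    have hY := (mul_eq_zero.1 hY).resolve_left hs
    rw [hz] at hX hY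
    refine hv (eq_zero_of_lines (w₁ := w₁) (w₂ := w₂) hd ?_ ?_ hz)
    · apply (mul_eq_zero.1 (?_ : (h₂ ^ 2 - 4 * h₁ * h₃) * _ = 0)).resolve_left hdisc
      linear_combination h₂ * hY - 2 * h₃ * hX
    · apply (mul_eq_zero.1 (?_ : (h₂ ^ 2 - 4 * h₁ * h₃) * _ = 0)).resolve_left hdisc
      linear_combination h₂ * hX - 2 * h₁ * hY
  exact ⟨hs, by simpa [hs] using hZ⟩

theorem nowhereTangent_line_z (hd : u₁ * v₂ - u₂ * v₁ ≠ 0) :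
    NowhereTangent (line u₁ v₁ w₁) z := by
  intro v _ _ _
  rw [LinearIndependent.pair_iff]
  intro s t hst
  obtain ⟨hX, -, hZ⟩ := coeff_eq_zero_of_lines hd (v := v) (w₁ := w₁) (w₂ := 0)
    (a := s) (b := 0) (d := t) fun j => by
      have := congrFun hst j
      simp only [Pi.add_apply, Pi.smul_apply, smul_eq_mul, Pi.zero_apply] at this
      linear_combination this
  exact ⟨hX, hZ⟩

theorem nowhereTangent_line_line (hd : u₁ * v₂ - u₂ * v₁ ≠ 0) :
    NowhereTangent (line u₁ v₁ w₁) (line u₂ v₂ w₂) := by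
  intro v _ _ _
  rw [LinearIndependent.pair_iff]
  intro s t hst
  obtain ⟨hX, hY, -⟩ := coeff_eq_zero_of_lines hd (v := v) (w₁ := w₁) (w₂ := w₂)
    (a := s) (b := t) (d := 0) fun j => by
      have := congrFun hst j
      simp only [Pi.add_apply, Pi.smul_apply, smul_eq_mul, Pi.zero_apply] at this
      linear_combination this
  exact ⟨hX, hY⟩

theorem nowhereTangent_lineConic_line (hd : u₁ * v₂ - u₂ * v₁ ≠ 0)
    (ht : 4 * c * h₃ + e₂ ^ 2 ≠ 0) :
    NowhereTangent (lineConic (line u₁ v₁ w₁) (line u₂ v₂ w₂) h₁ h₂ h₃ e₁ e₂ c)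
      (line u₁ v₁ w₁) := by
  intro v hv _ hL
  rw [LinearIndependent.pair_iff]
  intro s t hst
  obtain ⟨hX, hY, hZ⟩ := coeff_eq_zero_of_lines hd (v := v) (w₁ := w₁) (w₂ := w₂)
    (a := s * (2 * h₁ * eval v (line u₁ v₁ w₁) + h₂ * eval v (line u₂ v₂ w₂) + e₁ * v 2) + t)
    (b := s * (h₂ * eval v (line u₁ v₁ w₁) + 2 * h₃ * eval v (line u₂ v₂ w₂) + e₂ * v 2))
    (d := s * (e₁ * eval v (line u₁ v₁ w₁) + e₂ * eval v (line u₂ v₂ w₂) - 2 * c * v 2))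
    fun j => by
      have := congrFun hst j
      simp only [Pi.add_apply, Pi.smul_apply, smul_eq_mul, grad_lineConic, Pi.zero_apply] at this
      linear_combination this
  have hs : s = 0 := by
    by_contra hs
    have hY := (mul_eq_zero.1 hY).resolve_left hs
    have hZ := (mul_eq_zero.1 hZ).resolve_left hs
    rw [hL] at hY hZ
    refine hv (eq_zero_of_lines (w₁ := w₁) (w₂ := w₂) hd hL ?_ ?_)
    · apply (mul_eq_zero.1 (?_ : (4 * c * h₃ + e₂ ^ 2) * _ = 0)).resolve_left ht
      linear_combination 2 * c * hY + e₂ * hZ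
    · apply (mul_eq_zero.1 (?_ : (4 * c * h₃ + e₂ ^ 2) * _ = 0)).resolve_left ht
      linear_combination e₂ * hY - 2 * h₃ * hZ
  exact ⟨hs, by simpa [hs] using hX⟩

theorem lineConic_swap (L M : Poly) :
    lineConic L M h₁ h₂ h₃ e₁ e₂ c = lineConic M L h₃ h₂ h₁ e₂ e₁ c := by
  rw [lineConic, lineConic]; ring

theorem isSmoothCurve_line (hd : u₁ * v₂ - u₂ * v₁ ≠ 0) : IsSmoothCurve (line u₁ v₁ w₁) := by
  intro v _ _ h
  rw [grad_line] at h
  have e0 := congrFun h 0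
  have e1 := congrFun h 1
  simp only [Matrix.cons_val_zero, Matrix.cons_val_one, Pi.zero_apply] at e0 e1
  exact hd (by rw [e0, e1]; ring)

theorem forall_fin_three_pairs {R : Fin 3 → Fin 3 → Prop} (hsymm : ∀ i j, R i j → R j i)
    (h01 : R 0 1) (h02 : R 0 2) (h12 : R 1 2) : ∀ i j, i ≠ j → R i j := by
  intro i j hij
  fin_cases i <;> fin_cases j <;> first
    | exact absurd rfl hij
    | assumption
    | (apply hsymm; assumption)

theorem forall_fin_three_of_ne {i j k : Fin 3} (hij : i ≠ j) (hjk : j ≠ k) (hik : i ≠ k)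
    {R : Fin 3 → Prop} (hi : R i) (hj : R j) (hk : R k) : ∀ l, R l := by
  intro l
  have h : l = i ∨ l = j ∨ l = k := by omega
  rcases h with rfl | rfl | rfl <;> assumption

theorem IsSmoothCurve.ne_zero {F : Poly} (h : IsSmoothCurve F) : F ≠ 0 := by
  rintro rfl
  exact h ![1, 0, 0] (fun h => one_ne_zero (congrFun h 0)) (map_zero _) (by ext j; simp [grad])

theorem generalPosition_lineConic (hd : u₁ * v₂ - u₂ * v₁ ≠ 0)
    (hg : GenericConic h₁ h₂ h₃ e₁ e₂ c) :
    GeneralPosition ![2, 1, 1] ![lineConic (line u₁ v₁ w₁) (line u₂ v₂ w₂) h₁ h₂ h₃ e₁ e₂ c,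
      line u₁ v₁ w₁, line u₂ v₂ w₂] := by
  have hd' : u₂ * v₁ - u₁ * v₂ ≠ 0 := fun h => hd (by linear_combination -h)
  have hsm := isSmoothCurve_lineConic (w₁ := w₁) (w₂ := w₂) hd hg.c_ne hg.smooth_ne
  have hthree : ∀ v : Fin 3 → ℂ, v ≠ 0 →
      eval v (lineConic (line u₁ v₁ w₁) (line u₂ v₂ w₂) h₁ h₂ h₃ e₁ e₂ c) = 0 →
      eval v (line u₁ v₁ w₁) = 0 → eval v (line u₂ v₂ w₂) = 0 → False := by
    intro v hv hC hL hM
    rw [eval_lineConic, hL, hM] at hC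
    exact hv (eq_zero_of_lines hd hL hM (by simpa [hg.c_ne] using hC))
  refine ⟨fun i => ?_, fun i => ?_, fun i => ?_, ?_, ?_, ?_⟩
  · fin_cases i
    · exact ⟨two_pos, hsm.ne_zero, isHomogeneous_lineConic (isHomogeneous_line ..)
        (isHomogeneous_line ..) ..⟩
    · exact isCurve_line hd
    · exact isCurve_line hd'
  · fin_cases i
    · exact hsm
    · exact isSmoothCurve_line hd
    · exact isSmoothCurve_line hd'
  · fin_cases i
    · exact nowhereTangent_lineConic_z hd hg.disc_ne
    · exact nowhereTangent_line_z hd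
    · exact nowhereTangent_line_z hd'
  · refine forall_fin_three_pairs (fun i j h => h.symm) ?_ ?_ ?_
    · exact nowhereTangent_lineConic_line hd hg.tangent₃_ne
    · simp only [Matrix.cons_val_zero, Matrix.cons_val]
      rw [lineConic_swap]
      exact nowhereTangent_lineConic_line hd' hg.tangent₁_ne
    · exact nowhereTangent_line_line hd
  · refine forall_fin_three_pairs (fun i j h v hv hz hij => h v hv hz hij.symm) ?_ ?_ ?_
    · rintro v hv hz ⟨hC, hL⟩
      simp only [Matrix.cons_val_zero, Matrix.cons_val_one] at hC hL
      rw [eval_lineConic, hL, hz] at hC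
      exact hv (eq_zero_of_lines hd hL (by simpa [hg.h₃_ne] using hC) hz)
    · rintro v hv hz ⟨hC, hM⟩
      simp only [Matrix.cons_val_zero, Matrix.cons_val] at hC hM
      rw [eval_lineConic, hM, hz] at hC
      exact hv (eq_zero_of_lines hd (by simpa [hg.h₁_ne] using hC) hM hz)
    · rintro v hv hz ⟨hL, hM⟩
      exact hv (eq_zero_of_lines hd hL hM hz)
  · rintro i j k hij hjk hik v hv ⟨hi, hj, hk⟩
    have h := forall_fin_three_of_ne hij hjk hik
      (R := fun l => eval v (![lineConic (line u₁ v₁ w₁) (line u₂ v₂ w₂) h₁ h₂ h₃ e₁ e₂ c,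
        line u₁ v₁ w₁, line u₂ v₂ w₂] l) = 0) hi hj hk
    exact hthree v hv (h 0) (h 1) (h 2)

/-- A logarithmic form along a conic and two lines in general position. -/
theorem logForm_mem_YDarboux (hd : u₁ * v₂ - u₂ * v₁ ≠ 0) (hg : GenericConic h₁ h₂ h₃ e₁ e₂ c)
    {α₁ α₂ α₃ : ℂ} {ω : DiffForm} (hV : ω ∈ V 3)
    (h : ω = logForm α₁ α₂ α₃ (lineConic (line u₁ v₁ w₁) (line u₂ v₂ w₂) h₁ h₂ h₃ e₁ e₂ c)
      (line u₁ v₁ w₁) (line u₂ v₂ w₂)) : ω ∈ YDarboux 3 ![2, 1, 1] := by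
  have hgp := generalPosition_lineConic (w₁ := w₁) (w₂ := w₂) hd hg
  refine ⟨hV, by simp [Fin.sum_univ_three], _, hgp, ?_⟩
  rw [h]
  exact (darbouxIntegrableWith_logForm α₁ α₂ α₃ _ _ _ (hgp.curve 0) (hgp.curve 1)
    (hgp.curve 2)).1

end

/-! ### Radial forms -/

/-- The data of a form `S dℓ - ℓ dS + 2(g + dℓ)(X dY - Y dX)`, where `X = x - a`, `Y = y - b`, the
binary forms `S` and `g` in `X`, `Y` have coefficients `s₁, s₂, s₃` and `g₁, g₂, g₃`, and
`ℓ = l₀ + l₁x + l₂y`. -/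
@[ext] structure Radial where
  a : ℂ
  b : ℂ
  s₁ : ℂ
  s₂ : ℂ
  s₃ : ℂ
  l₀ : ℂ
  l₁ : ℂ
  l₂ : ℂ
  g₁ : ℂ
  g₂ : ℂ
  g₃ : ℂ
  d : ℂ

namespace Radial

/-- The function `X` on the plane, homogenised. -/
def X (r : Radial) : Poly := x - C r.a * z

/-- The function `Y` on the plane, homogenised. -/
def Y (r : Radial) : Poly := y - C r.b * z

/-- The binary form `S`. -/
def S (r : Radial) : Poly := C r.s₁ * r.X * r.X + C r.s₂ * r.X * r.Y + C r.s₃ * r.Y * r.Y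

/-- The affine function `ℓ`, homogenised. -/
def ell (r : Radial) : Poly := C r.l₁ * x + C r.l₂ * y + C r.l₀ * z

/-- The cofactor `2(g + dℓ)` of `X dY - Y dX`, homogenised. -/
def G (r : Radial) : Poly :=
  C 2 * (C r.g₁ * r.X * r.X + C r.g₂ * r.X * r.Y + C r.g₃ * r.Y * r.Y + C r.d * r.ell * z)

/-- The differential form with the given data, homogenised. -/
def form (r : Radial) : DiffForm where
  P := r.S * z * C r.l₁ - r.ell * z * (C (2 * r.s₁) * r.X + C r.s₂ * r.Y) - r.G * r.Y
  Q := r.S * z * C r.l₂ - r.ell * z * (C r.s₂ * r.X + C (2 * r.s₃) * r.Y) + r.G * r.X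

theorem form_mem_V (r : Radial) : r.form ∈ V 3 := by
  have hC (c : ℂ) := isHomogeneous_C (Fin 3) c
  have hx : x.IsHomogeneous 1 := isHomogeneous_X ℂ 0
  have hy : y.IsHomogeneous 1 := isHomogeneous_X ℂ 1
  have hz : z.IsHomogeneous 1 := isHomogeneous_X ℂ 2
  have h1 {F : Poly} (c : ℂ) (hF : F.IsHomogeneous 1) : (C c * F).IsHomogeneous 1 := by
    simpa using (hC c).mul hF
  have h2 {F H : Poly} (c : ℂ) (hF : F.IsHomogeneous 1) (hH : H.IsHomogeneous 1) :
      (C c * F * H).IsHomogeneous 2 := by simpa using (h1 c hF).mul hH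
  have hX : r.X.IsHomogeneous 1 := hx.sub (h1 _ hz)
  have hY : r.Y.IsHomogeneous 1 := hy.sub (h1 _ hz)
  have hl : r.ell.IsHomogeneous 1 := ((h1 _ hx).add (h1 _ hy)).add (h1 _ hz)
  have hS : r.S.IsHomogeneous 2 := ((h2 _ hX hX).add (h2 _ hX hY)).add (h2 _ hY hY)
  have hG : r.G.IsHomogeneous 2 := by
    rw [G]
    simpa using (hC 2).mul ((((h2 r.g₁ hX hX).add (h2 r.g₂ hX hY)).add (h2 r.g₃ hY hY)).add
      (h2 r.d hl hz))
  have hSz (c : ℂ) : (r.S * z * C c).IsHomogeneous 3 := by simpa using (hS.mul hz).mul (hC c)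
  have hlz (c c' : ℂ) : (r.ell * z * (C c * r.X + C c' * r.Y)).IsHomogeneous 3 := by
    simpa using (hl.mul hz).mul ((h1 c hX).add (h1 c' hY))
  exact ⟨((hSz _).sub (hlz _ _)).sub (hG.mul hY), ((hSz _).sub (hlz _ _)).add (hG.mul hX)⟩

/-- The conditions on the data for a Poincaré form: `P = Q = 0`, `P_x = Q_y = 1`,
`P_y = Q_x = 0` at the origin. -/
theorem form_mem_poincare_iff (r : Radial) : r.form ∈ poincare 3 ↔
    ((r.s₁ * r.a ^ 2 + r.s₂ * r.a * r.b + r.s₃ * r.b ^ 2) * r.l₁ +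
      r.l₀ * (2 * r.s₁ * r.a + r.s₂ * r.b) + 2 * r.b *
        (r.g₁ * r.a ^ 2 + r.g₂ * r.a * r.b + r.g₃ * r.b ^ 2 + r.d * r.l₀) = 0) ∧
    ((r.s₁ * r.a ^ 2 + r.s₂ * r.a * r.b + r.s₃ * r.b ^ 2) * r.l₂ +
      r.l₀ * (r.s₂ * r.a + 2 * r.s₃ * r.b) - 2 * r.a *
        (r.g₁ * r.a ^ 2 + r.g₂ * r.a * r.b + r.g₃ * r.b ^ 2 + r.d * r.l₀) = 0) ∧
    (-2 * r.l₀ * r.s₁ + 2 * r.b * (r.d * r.l₁ - (2 * r.g₁ * r.a + r.g₂ * r.b)) = 1) ∧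
    (-2 * r.l₀ * r.s₃ - 2 * r.a * (r.d * r.l₂ - (r.g₂ * r.a + 2 * r.g₃ * r.b)) = 1) ∧
    (-(r.s₂ * r.a + 2 * r.s₃ * r.b) * r.l₁ + r.l₂ * (2 * r.s₁ * r.a + r.s₂ * r.b) - r.l₀ * r.s₂ +
      2 * r.b * (r.d * r.l₂ - (r.g₂ * r.a + 2 * r.g₃ * r.b)) -
        2 * (r.g₁ * r.a ^ 2 + r.g₂ * r.a * r.b + r.g₃ * r.b ^ 2 + r.d * r.l₀) = 0) ∧
    (-(2 * r.s₁ * r.a + r.s₂ * r.b) * r.l₂ + r.l₁ * (r.s₂ * r.a + 2 * r.s₃ * r.b) - r.l₀ * r.s₂ -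
      2 * r.a * (r.d * r.l₁ - (2 * r.g₁ * r.a + r.g₂ * r.b)) +
        2 * (r.g₁ * r.a ^ 2 + r.g₂ * r.a * r.b + r.g₃ * r.b ^ 2 + r.d * r.l₀) = 0) := by
  simp only [poincare, Set.mem_ofPred_eq, form_mem_V, true_and]
  simp only [form, S, X, Y, ell, G, origin, map_add, map_sub, map_mul, Derivation.leibniz,
    smul_eq_mul, pderiv_C, pderiv_X, eval_C, eval_X, Matrix.cons_val_zero, Matrix.cons_val_one,
    Matrix.cons_val, Pi.single_apply, Fin.reduceEq, if_true, if_false, map_zero, map_one]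
  have key {u v u' v' : ℂ} (h : u = u') (h' : v = v') : u = v ↔ u' = v' := by rw [h, h']
  refine and_congr (key ?_ rfl) (and_congr (key ?_ rfl) (and_congr (key ?_ rfl)
    (and_congr (key ?_ rfl) (and_congr (key ?_ rfl) (key ?_ rfl))))) <;> ring

/-- The data depend continuously on a parameter. -/
structure ContinuousFamily (r : ℂ → Radial) : Prop where
  a : Continuous fun t => (r t).a
  b : Continuous fun t => (r t).b
  s₁ : Continuous fun t => (r t).s₁
  s₂ : Continuous fun t => (r t).s₂
  s₃ : Continuous fun t => (r t).s₃
  l₀ : Continuous fun t => (r t).l₀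
  l₁ : Continuous fun t => (r t).l₁
  l₂ : Continuous fun t => (r t).l₂
  g₁ : Continuous fun t => (r t).g₁
  g₂ : Continuous fun t => (r t).g₂
  g₃ : Continuous fun t => (r t).g₃
  d : Continuous fun t => (r t).d

theorem ContinuousFamily.coords_form {r : ℂ → Radial} (h : ContinuousFamily r)
    (s : Fin 2 × (Fin 3 →₀ ℕ)) : Continuous fun t => coords (r t).form s := by
  have hC {c : ℂ → ℂ} (hc : Continuous c) := CoeffContinuous.ofC (σ := Fin 3) hc
  have hk (p : Poly) := CoeffContinuous.const p
  have h2 {c : ℂ → ℂ} (hc : Continuous c) : Continuous fun t => 2 * c t := continuous_const.mul hc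
  have hX : CoeffContinuous fun t => (r t).X := (hk _).sub ((hC h.a).mul (hk _))
  have hY : CoeffContinuous fun t => (r t).Y := (hk _).sub ((hC h.b).mul (hk _))
  have hl : CoeffContinuous fun t => (r t).ell :=
    (((hC h.l₁).mul (hk _)).add ((hC h.l₂).mul (hk _))).add ((hC h.l₀).mul (hk _))
  have hS : CoeffContinuous fun t => (r t).S :=
    ((((hC h.s₁).mul hX).mul hX).add (((hC h.s₂).mul hX).mul hY)).add (((hC h.s₃).mul hY).mul hY)
  have hG : CoeffContinuous fun t => (r t).G := (hk _).mul
    (((((((hC h.g₁).mul hX).mul hX).add (((hC h.g₂).mul hX).mul hY)).add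
      (((hC h.g₃).mul hY).mul hY))).add (((hC h.d).mul hl).mul (hk _)))
  have hP : CoeffContinuous fun t => (r t).form.P :=
    ((((hS.mul (hk _)).mul (hC h.l₁))).sub
      ((hl.mul (hk _)).mul (((hC (h2 h.s₁)).mul hX).add ((hC h.s₂).mul hY)))).sub (hG.mul hY)
  have hQ : CoeffContinuous fun t => (r t).form.Q :=
    ((((hS.mul (hk _)).mul (hC h.l₂))).sub
      ((hl.mul (hk _)).mul (((hC h.s₂).mul hX).add ((hC (h2 h.s₃)).mul hY)))).add (hG.mul hX)
  unfold coords
  split_ifs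
  · exact hP s.2
  · exact hQ s.2

/-- A Poincaré form is in the closure if nearby members of a continuous family are. -/
theorem ContinuousFamily.mem_zariskiClosure {r : ℂ → Radial} (h : ContinuousFamily r) {t₀ : ℂ}
    {T : Set DiffForm} (h₀ : (r t₀).form ∈ poincare 3)
    (hev : ∀ᶠ t in 𝓝[≠] t₀, (r t).form ∈ zariskiClosure 3 T) :
    (r t₀).form ∈ zariskiClosure 3 T :=
  mem_zariskiClosure_of_eventually h.coords_form h₀ hev

/-- The data of the logarithmic form with residues `1`, `-1 - k`, `-1 + k` along the conic
`h₁L² + h₂LM + h₃M² + e₁L + e₂M = c` and the lines `L = 0`, `M = 0`, where `L = u₁X + v₁Y` and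
`M = u₂X + v₂Y`. -/
def ofLog (a b u₁ v₁ u₂ v₂ h₁ h₂ h₃ e₁ e₂ c k : ℂ) : Radial where
  a := a
  b := b
  s₁ := u₁ * u₂
  s₂ := u₁ * v₂ + u₂ * v₁
  s₃ := v₁ * v₂
  l₀ := -c - (e₁ * u₁ + e₂ * u₂) * a - (e₁ * v₁ + e₂ * v₂) * b
  l₁ := e₁ * u₁ + e₂ * u₂
  l₂ := e₁ * v₁ + e₂ * v₂
  g₁ := (u₁ * v₂ - u₂ * v₁) / 2 *
    ((k - 1) * h₁ * u₁ ^ 2 + k * h₂ * u₁ * u₂ + (k + 1) * h₃ * u₂ ^ 2)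
  g₂ := (u₁ * v₂ - u₂ * v₁) / 2 * (2 * (k - 1) * h₁ * u₁ * v₁ +
    k * h₂ * (u₁ * v₂ + u₂ * v₁) + 2 * (k + 1) * h₃ * u₂ * v₂)
  g₃ := (u₁ * v₂ - u₂ * v₁) / 2 *
    ((k - 1) * h₁ * v₁ ^ 2 + k * h₂ * v₁ * v₂ + (k + 1) * h₃ * v₂ ^ 2)
  d := k * (u₁ * v₂ - u₂ * v₁) / 2

/-- For binary quadratic forms `S = LM` and `h` the form `S dh - h dS` is a multiple of
`X dY - Y dX`; this brings `S dF - F dS + k F (L dM - M dL)`, for the conic `F = h + ℓ`, into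
radial shape. -/
theorem form_ofLog (a b u₁ v₁ u₂ v₂ h₁ h₂ h₃ e₁ e₂ c k : ℂ) :
    (ofLog a b u₁ v₁ u₂ v₂ h₁ h₂ h₃ e₁ e₂ c k).form = logForm 1 (-1 - k) (-1 + k)
      (lineConic (line u₁ v₁ (-(u₁ * a + v₁ * b))) (line u₂ v₂ (-(u₂ * a + v₂ * b)))
        h₁ h₂ h₃ e₁ e₂ c)
      (line u₁ v₁ (-(u₁ * a + v₁ * b))) (line u₂ v₂ (-(u₂ * a + v₂ * b))) := by
  have hgC (v : Fin 3 → ℂ) (j : Fin 3) := grad_lineConic (h₁ := h₁) (h₂ := h₂) (h₃ := h₃)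
    (e₁ := e₁) (e₂ := e₂) (c := c) (line u₁ v₁ (-(u₁ * a + v₁ * b)))
    (line u₂ v₂ (-(u₂ * a + v₂ * b))) v j
  have hg₁ (v : Fin 3 → ℂ) (j : Fin 3) :=
    congrFun (grad_line (u₁ := u₁) (v₁ := v₁) (w₁ := -(u₁ * a + v₁ * b)) v) j
  have hg₂ (v : Fin 3 → ℂ) (j : Fin 3) :=
    congrFun (grad_line (u₁ := u₂) (v₁ := v₂) (w₁ := -(u₂ * a + v₂ * b)) v) j
  simp only [grad_z, hg₁, hg₂] at hgC
  simp only [grad] at hgC hg₁ hg₂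
  ext1 <;> refine MvPolynomial.funext fun v => ?_ <;>
  · simp only [logForm, map_add, map_mul, hgC, hg₁, hg₂, eval_lineConic, eval_line, eval_C,
      form, ofLog, S, X, Y, ell, G, map_sub, eval_X, Matrix.cons_val_zero, Matrix.cons_val_one]
    ring

theorem ofLog_mem_YDarboux {u₁ v₁ u₂ v₂ h₁ h₂ h₃ e₁ e₂ c : ℂ} (hd : u₁ * v₂ - u₂ * v₁ ≠ 0)
    (hg : GenericConic h₁ h₂ h₃ e₁ e₂ c) (a b k : ℂ) :
    (ofLog a b u₁ v₁ u₂ v₂ h₁ h₂ h₃ e₁ e₂ c k).form ∈ YDarboux 3 ![2, 1, 1] :=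
  logForm_mem_YDarboux hd hg (form_mem_V _) (form_ofLog ..)

end Radial

/-! ### Perturbing a conic into general position -/

theorem eventually_quadratic_ne_zero {p q : ℂ} (h : p ≠ 0 ∨ q ≠ 0) (r t₀ : ℂ) :
    ∀ᶠ t in 𝓝[≠] t₀, p * t ^ 2 + q * t + r ≠ 0 := by
  have hf : Differentiable ℂ fun t : ℂ => p * t ^ 2 + q * t + r := by fun_prop
  by_contra hne
  have h0 (t : ℂ) : p * t ^ 2 + q * t + r = 0 := by
    by_contra ht
    exact hne (eventually_ne_zero hf t ht t₀)
  have h1 := h0 1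
  have h2 := h0 (-1)
  have h3 := h0 0
  rcases h with h | h
  · exact h (by linear_combination h1 / 2 + h2 / 2 - h3)
  · exact h (by linear_combination h1 / 2 - h2 / 2)

/-- Adding multiples of a binary form `p` prime to `LM` and with distinct roots brings a conic into
general position. -/
theorem eventually_genericConic {p₁ p₂ p₃ c : ℂ} (hc : c ≠ 0) (hp₁ : p₁ ≠ 0) (hp₃ : p₃ ≠ 0)
    (hp : p₂ ^ 2 - 4 * p₁ * p₃ ≠ 0) (q₁ q₂ q₃ e₁ e₂ t₀ : ℂ) :
    ∀ᶠ t in 𝓝[≠] t₀, GenericConic (p₁ * t + q₁) (p₂ * t + q₂) (p₃ * t + q₃) e₁ e₂ c := by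
  have h4 : (4 : ℂ) ≠ 0 := by norm_num
  have h4c : 4 * c ≠ 0 := mul_ne_zero h4 hc
  filter_upwards [
    eventually_quadratic_ne_zero (p := 0) (.inr hp₁) q₁ t₀,
    eventually_quadratic_ne_zero (p := 0) (.inr hp₃) q₃ t₀,
    eventually_quadratic_ne_zero (q := 2 * p₂ * q₂ - 4 * (p₁ * q₃ + p₃ * q₁)) (.inl hp)
      (q₂ ^ 2 - 4 * q₁ * q₃) t₀,
    eventually_quadratic_ne_zero (p := 0) (.inr (mul_ne_zero h4c hp₁)) (4 * c * q₁ + e₁ ^ 2) t₀,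
    eventually_quadratic_ne_zero (p := 0) (.inr (mul_ne_zero h4c hp₃)) (4 * c * q₃ + e₂ ^ 2) t₀,
    eventually_quadratic_ne_zero (q := 2 * (4 * c * p₂) * (4 * c * q₂ + 2 * e₁ * e₂) -
      4 * (4 * c * p₁ * (4 * c * q₃ + e₂ ^ 2) + 4 * c * p₃ * (4 * c * q₁ + e₁ ^ 2)))
      (.inl (mul_ne_zero (pow_ne_zero 2 h4c) hp))
      ((4 * c * q₂ + 2 * e₁ * e₂) ^ 2 - 4 * (4 * c * q₁ + e₁ ^ 2) * (4 * c * q₃ + e₂ ^ 2)) t₀]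
    with t i1 i2 i3 i4 i5 i6
  exact ⟨hc, fun h => i1 (by linear_combination h), fun h => i2 (by linear_combination h),
    fun h => i3 (by linear_combination h), fun h => i4 (by linear_combination h),
    fun h => i5 (by linear_combination h), fun h => i6 (by linear_combination h)⟩

/-- If a conic does not pass through `L = M = 0`, meets `L = 0` in two distinct points and these are
not at infinity, then adding multiples of `L²` brings it into general position. -/
theorem eventually_genericConic_left {h₃ e₂ c : ℂ} (hc : c ≠ 0) (hh₃ : h₃ ≠ 0)
    (ht : 4 * c * h₃ + e₂ ^ 2 ≠ 0) (h₂ e₁ t₀ : ℂ) :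
    ∀ᶠ t in 𝓝[≠] t₀, GenericConic t h₂ h₃ e₁ e₂ c := by
  have h4 : (4 : ℂ) ≠ 0 := by norm_num
  have h4c : 4 * c ≠ 0 := mul_ne_zero h4 hc
  filter_upwards [
    eventually_quadratic_ne_zero (p := 0) (.inr one_ne_zero) 0 t₀,
    eventually_quadratic_ne_zero (p := 0) (.inr (mul_ne_zero h4 hh₃)) (-h₂ ^ 2) t₀,
    eventually_quadratic_ne_zero (p := 0) (.inr h4c) (e₁ ^ 2) t₀,
    eventually_quadratic_ne_zero (p := 0) (.inr (mul_ne_zero (mul_ne_zero h4 h4c) ht))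
      (4 * e₁ ^ 2 * (4 * c * h₃ + e₂ ^ 2) - (4 * c * h₂ + 2 * e₁ * e₂) ^ 2) t₀]
    with t i1 i2 i3 i4
  exact ⟨hc, fun h => i1 (by linear_combination h), hh₃, fun h => i2 (by linear_combination -h),
    fun h => i3 (by linear_combination h), ht, fun h => i4 (by linear_combination -h)⟩

/-- The Zariski closure of the Poincaré forms with a conic and two lines in general position. -/
abbrev closure211 : Set DiffForm := zariskiClosure 3 (XDarboux 3 ![2, 1, 1])

namespace Radial

/-! ### Forms whose two lines avoid the origin -/

/-- The Poincaré forms of radial shape with `S = M² - w²N²`, where `M = m₁X + m₂Y` and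
`N = aY - bX`. If `am₁ + bm₂ = 1`, then `M = -1` and `N = 0` at the origin, and being a Poincaré
form determines `ℓ` and all coefficients of `g` in terms of `M²`, `MN`, `N²` but the last one,
`γ`. -/
def offLines (a b m₁ m₂ w d γ : ℂ) : Radial where
  a := a
  b := b
  s₁ := m₁ ^ 2 - w ^ 2 * b ^ 2
  s₂ := 2 * m₁ * m₂ + 2 * w ^ 2 * a * b
  s₃ := m₂ ^ 2 - w ^ 2 * a ^ 2
  l₀ := -(a ^ 2 + b ^ 2) / 2
  l₁ := a
  l₂ := b
  g₁ := ((b * m₁ - a * m₂) / 2 + d * (a ^ 2 + b ^ 2) / 2) * m₁ ^ 2 -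
    ((m₁ ^ 2 + m₂ ^ 2) / 2 + (a ^ 2 + b ^ 2) / 2 * w ^ 2 + d * (b * m₁ - a * m₂)) * (m₁ * b) +
    γ * b ^ 2
  g₂ := ((b * m₁ - a * m₂) / 2 + d * (a ^ 2 + b ^ 2) / 2) * (2 * m₁ * m₂) +
    ((m₁ ^ 2 + m₂ ^ 2) / 2 + (a ^ 2 + b ^ 2) / 2 * w ^ 2 + d * (b * m₁ - a * m₂)) *
      (a * m₁ - b * m₂) - 2 * γ * a * b
  g₃ := ((b * m₁ - a * m₂) / 2 + d * (a ^ 2 + b ^ 2) / 2) * m₂ ^ 2 +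
    ((m₁ ^ 2 + m₂ ^ 2) / 2 + (a ^ 2 + b ^ 2) / 2 * w ^ 2 + d * (b * m₁ - a * m₂)) * (m₂ * a) +
    γ * a ^ 2
  d := d

theorem offLines_mem_poincare {a b m₁ m₂ : ℂ} (h : a * m₁ + b * m₂ = 1) (w d γ : ℂ) :
    (offLines a b m₁ m₂ w d γ).form ∈ poincare 3 := by
  rw [form_mem_poincare_iff]
  simp only [offLines]
  refine ⟨?_, ?_, ?_, ?_, ?_, ?_⟩ <;> grind

/-- For general `w` and `d` the form is logarithmic, along the lines `M ± wN = 0` and the conic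
`η₁M² + η₂MN + η₃N² + ℓ = 0`. -/
theorem offLines_eq_ofLog {a b m₁ m₂ w d : ℂ} (h : a * m₁ + b * m₂ = 1) (hw : w ≠ 0)
    {η₁ η₂ η₃ : ℂ} (h₂ : η₂ = b * m₁ - a * m₂ + d * (a ^ 2 + b ^ 2) - 2 * d * η₁)
    (h₃ : η₃ = (m₁ ^ 2 + m₂ ^ 2) / 2 + (a ^ 2 + b ^ 2) / 2 * w ^ 2 + d * (b * m₁ - a * m₂) -
      w ^ 2 * η₁ - d * η₂) :
    offLines a b m₁ m₂ w d (w ^ 2 * η₂ / 2 + d * η₃) =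
      ofLog a b (m₁ - w * b) (m₂ + w * a) (m₁ + w * b) (m₂ - w * a)
        ((η₁ + η₂ / w + η₃ / w ^ 2) / 4) ((η₁ - η₃ / w ^ 2) / 2)
        ((η₁ - η₂ / w + η₃ / w ^ 2) / 4)
        ((a ^ 2 + b ^ 2) / 2 + (b * m₁ - a * m₂) / (2 * w))
        ((a ^ 2 + b ^ 2) / 2 - (b * m₁ - a * m₂) / (2 * w)) (-(a ^ 2 + b ^ 2) / 2) (-d / w) := by
  have hσ : (m₁ - w * b) * (m₂ - w * a) - (m₁ + w * b) * (m₂ + w * a) = -2 * w := by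
    linear_combination -2 * w * h
  obtain ⟨τ, hτ⟩ : ∃ τ, τ = b * m₁ - a * m₂ := ⟨_, rfl⟩
  rw [← hτ] at h₂ h₃
  have k₁ : τ / 2 + d * (a ^ 2 + b ^ 2) / 2 = η₂ / 2 + d * η₁ := by
    linear_combination -h₂ / 2
  have k₂ : (m₁ ^ 2 + m₂ ^ 2) / 2 + (a ^ 2 + b ^ 2) / 2 * w ^ 2 + d * τ =
      η₃ + w ^ 2 * η₁ + d * η₂ := by linear_combination -h₃
  have hl₁ : ((a ^ 2 + b ^ 2) / 2 + τ / (2 * w)) * (m₁ - w * b) +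
      ((a ^ 2 + b ^ 2) / 2 - τ / (2 * w)) * (m₁ + w * b) = a := by
    field_simp
    linear_combination 2 * w * (a * h - b * hτ)
  have hl₂ : ((a ^ 2 + b ^ 2) / 2 + τ / (2 * w)) * (m₂ + w * a) +
      ((a ^ 2 + b ^ 2) / 2 - τ / (2 * w)) * (m₂ - w * a) = b := by
    field_simp
    linear_combination 2 * w * (b * h + a * hτ)
  ext <;> simp only [offLines, ofLog, hσ, ← hτ, k₁, k₂, hl₁, hl₂] <;> field_simp <;> ring

theorem offLines_mem_closure_of_generic {a b m₁ m₂ w d : ℂ} (h : a * m₁ + b * m₂ = 1) (hw : w ≠ 0)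
    (hd : d ≠ 0) (hdw : d ^ 2 - w ^ 2 ≠ 0) (hab : a ^ 2 + b ^ 2 ≠ 0) (γ : ℂ) :
    (offLines a b m₁ m₂ w d γ).form ∈ closure211 := by
  obtain ⟨τ, hτ⟩ : ∃ τ, τ = b * m₁ - a * m₂ + d * (a ^ 2 + b ^ 2) := ⟨_, rfl⟩
  obtain ⟨υ, hυ⟩ : ∃ υ, υ = (m₁ ^ 2 + m₂ ^ 2) / 2 + (a ^ 2 + b ^ 2) / 2 * w ^ 2 +
    d * (b * m₁ - a * m₂) - d * τ := ⟨_, rfl⟩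
  have hw2 : w ^ 2 ≠ 0 := pow_ne_zero 2 hw
  have hσ : (m₁ - w * b) * (m₂ - w * a) - (m₁ + w * b) * (m₂ + w * a) ≠ 0 := by
    rw [show (m₁ - w * b) * (m₂ - w * a) - (m₁ + w * b) * (m₂ + w * a) = -2 * w by
      linear_combination -2 * w * h]
    exact mul_ne_zero (by norm_num) hw
  have hd₁ : d - w ≠ 0 := fun h0 => hdw (by linear_combination (d + w) * h0)
  have hd₂ : d + w ≠ 0 := fun h0 => hdw (by linear_combination (d - w) * h0)
  -- `M² - 2d MN + (2d² - w²)N²` is the direction in which the conic moves with `γ`.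
  set r : ℂ → Radial := fun t => offLines a b m₁ m₂ w d
    (w ^ 2 * (τ - 2 * d * t) / 2 + d * (υ - (w ^ 2 - 2 * d ^ 2) * t)) with hr
  obtain ⟨t₀, ht₀⟩ : ∃ t₀, r t₀ = offLines a b m₁ m₂ w d γ := by
    refine ⟨(γ - w ^ 2 * τ / 2 - d * υ) / (2 * d * (d ^ 2 - w ^ 2)), ?_⟩
    simp only [hr]
    congr 1
    field_simp
    ring
  have hc : ContinuousFamily r := by
    constructor <;> simp only [hr, offLines] <;> fun_prop
  rw [← ht₀]
  refine hc.mem_zariskiClosure (offLines_mem_poincare h ..) ?_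
  filter_upwards [eventually_genericConic (c := -(a ^ 2 + b ^ 2) / 2)
    (p₁ := d * (d - w) / (2 * w ^ 2)) (p₂ := (w ^ 2 - d ^ 2) / w ^ 2)
    (p₃ := d * (d + w) / (2 * w ^ 2)) (div_ne_zero (neg_ne_zero.2 hab) two_ne_zero)
    (div_ne_zero (mul_ne_zero hd hd₁) (mul_ne_zero two_ne_zero hw2))
    (div_ne_zero (mul_ne_zero hd hd₂) (mul_ne_zero two_ne_zero hw2))
    (by
      rw [show ((w ^ 2 - d ^ 2) / w ^ 2) ^ 2 - 4 * (d * (d - w) / (2 * w ^ 2)) *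
        (d * (d + w) / (2 * w ^ 2)) = -(d ^ 2 - w ^ 2) / w ^ 2 by field_simp; ring]
      exact div_ne_zero (neg_ne_zero.2 hdw) hw2)
    ((τ / w + υ / w ^ 2) / 4) (-(υ / w ^ 2) / 2) ((-(τ / w) + υ / w ^ 2) / 4)
    ((a ^ 2 + b ^ 2) / 2 + (b * m₁ - a * m₂) / (2 * w))
    ((a ^ 2 + b ^ 2) / 2 - (b * m₁ - a * m₂) / (2 * w)) t₀] with t ht
  refine subset_zariskiClosure Set.inter_subset_right ⟨?_, offLines_mem_poincare h ..⟩
  simp only [hr]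
  rw [offLines_eq_ofLog h hw (η₁ := t) (by rw [hτ]) (by rw [hυ]; ring)]
  refine ofLog_mem_YDarboux hσ ?_ ..
  convert ht using 1 <;> field_simp <;> ring

theorem offLines_mem_closure {a b m₁ m₂ : ℂ} (h : a * m₁ + b * m₂ = 1) (w d γ : ℂ) :
    (offLines a b m₁ m₂ w d γ).form ∈ closure211 := by
  -- The genericity assumptions are dropped one after the other: on `d`, on `w`, on `a² + b²`.
  have hd {a b m₁ m₂ : ℂ} (h : a * m₁ + b * m₂ = 1) {w : ℂ} (hw : w ≠ 0) (hab : a ^ 2 + b ^ 2 ≠ 0)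
      (d : ℂ) : (offLines a b m₁ m₂ w d γ).form ∈ closure211 := by
    have hc : ContinuousFamily fun t => offLines a b m₁ m₂ w t γ := by
      constructor <;> simp only [offLines] <;> fun_prop
    refine hc.mem_zariskiClosure (offLines_mem_poincare h ..) ?_
    filter_upwards [eventually_ne_zero (f := fun t => t * (t ^ 2 - w ^ 2)) (by fun_prop) (2 * w)
      (by ring_nf; simpa using hw) d] with t ht
    exact offLines_mem_closure_of_generic h hw (left_ne_zero_of_mul ht) (right_ne_zero_of_mul ht)
      hab γ
  have hw {a b m₁ m₂ : ℂ} (h : a * m₁ + b * m₂ = 1) (hab : a ^ 2 + b ^ 2 ≠ 0)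
      (w d : ℂ) : (offLines a b m₁ m₂ w d γ).form ∈ closure211 := by
    have hc : ContinuousFamily fun t => offLines a b m₁ m₂ t d γ := by
      constructor <;> simp only [offLines] <;> fun_prop
    refine hc.mem_zariskiClosure (offLines_mem_poincare h ..) ?_
    filter_upwards [eventually_ne_zero (f := fun t => t) (by fun_prop) 1 one_ne_zero w] with t ht
    exact hd h ht hab d
  have hc : ContinuousFamily fun t => offLines (a - t * m₂) (b + t * m₁) m₁ m₂ w d γ := by
    constructor <;> simp only [offLines] <;> fun_prop
  have h' (t : ℂ) : (a - t * m₂) * m₁ + (b + t * m₁) * m₂ = 1 := by linear_combination h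
  have h0 := hc.mem_zariskiClosure (t₀ := 0) (T := XDarboux 3 ![2, 1, 1])
    (offLines_mem_poincare (h' 0) ..) ?_
  · simpa using h0
  -- The discriminant of `a² + b²` as a polynomial in `t` is a nonzero multiple of `(am₁ + bm₂)²`.
  have hne : ∃ t : ℂ, (a - t * m₂) ^ 2 + (b + t * m₁) ^ 2 ≠ 0 := by
    by_contra! hall
    have i0 := hall 0
    have i1 := hall 1
    have i2 := hall (-1)
    have j1 : m₁ ^ 2 + m₂ ^ 2 = 0 := by linear_combination i1 / 2 + i2 / 2 - i0
    have j2 : b * m₁ - a * m₂ = 0 := by linear_combination i1 / 4 - i2 / 4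
    have : (a * m₁ + b * m₂) ^ 2 = 0 := by
      linear_combination (a ^ 2 + b ^ 2) * j1 - (b * m₁ - a * m₂) * j2
    simp [h] at this
  obtain ⟨t₁, ht₁⟩ := hne
  filter_upwards [eventually_ne_zero (f := fun t => (a - t * m₂) ^ 2 + (b + t * m₁) ^ 2)
    (by fun_prop) t₁ ht₁ 0] with t ht
  exact hw (h' t) ht w d

end Radial

namespace Radial

/-- The value of `S` at the origin. -/
def S₀ (r : Radial) : ℂ := r.s₁ * r.a ^ 2 + r.s₂ * r.a * r.b + r.s₃ * r.b ^ 2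

/-- The factor `S` may be divided by a constant by which `ℓ` is multiplied. -/
theorem form_scale (r : Radial) {μ : ℂ} (hμ : μ ≠ 0) :
    ({ r with
        s₁ := r.s₁ / μ, s₂ := r.s₂ / μ, s₃ := r.s₃ / μ
        l₀ := μ * r.l₀, l₁ := μ * r.l₁, l₂ := μ * r.l₂
        d := r.d / μ } : Radial).form = r.form := by
  ext1 <;> refine MvPolynomial.funext fun v => ?_ <;>
  · simp only [form, S, X, Y, ell, G, map_add, map_sub, map_mul, eval_C, eval_X]
    field_simp

theorem exists_eq_offLines {r : Radial} (hr : r.form ∈ poincare 3) (hS : r.S₀ = 1) :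
    ∃ m₁ m₂ w γ : ℂ, r.a * m₁ + r.b * m₂ = 1 ∧ r = offLines r.a r.b m₁ m₂ w r.d γ := by
  obtain ⟨h1, h2, h3, h4, h5, h6⟩ := r.form_mem_poincare_iff.1 hr
  rw [S₀] at hS
  obtain ⟨w, hw⟩ := IsAlgClosed.exists_pow_nat_eq (r.s₂ ^ 2 / 4 - r.s₁ * r.s₃) two_pos
  obtain ⟨a, b, s₁, s₂, s₃, l₀, l₁, l₂, g₁, g₂, g₃, d⟩ := r
  simp only at h1 h2 h3 h4 h5 h6 hS hw ⊢
  rw [hS, one_mul] at h1 h2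
  obtain ⟨m₁, hm₁⟩ : ∃ m₁, m₁ = s₁ * a + s₂ * b / 2 := ⟨_, rfl⟩
  obtain ⟨m₂, hm₂⟩ : ∃ m₂, m₂ = s₂ * a / 2 + s₃ * b := ⟨_, rfl⟩
  have hm : a * m₁ + b * m₂ = 1 := by rw [hm₁, hm₂]; linear_combination hS
  have q₁ : 2 * s₁ * a + s₂ * b = 2 * m₁ := by rw [hm₁]; ring
  have q₂ : s₂ * a + 2 * s₃ * b = 2 * m₂ := by rw [hm₂]; ring
  -- Contraction with the Euler field at the common point of the lines determines `ℓ`.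
  simp only [q₁, q₂] at h1 h2 h5 h6
  have hE : a * l₁ + b * l₂ + 2 * l₀ = 0 := by
    linear_combination a * h1 + b * h2 - 2 * l₀ * hm
  obtain rfl : a = l₁ := by
    linear_combination -(a * h3 + b * h6 - h1 + 2 * m₁ * hE + l₀ * q₁ - 2 * l₁ * hm)
  obtain rfl : b = l₂ := by
    linear_combination -(a * h5 + b * h4 - h2 + 2 * m₂ * hE + l₀ * q₂ - 2 * l₂ * hm)
  obtain rfl : l₀ = -(a ^ 2 + b ^ 2) / 2 := by linear_combination hE / 2
  have hs₁ : s₁ = m₁ ^ 2 - w ^ 2 * b ^ 2 := by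
    rw [hw, hm₁]; linear_combination -s₁ * hS
  have hs₂ : s₂ = 2 * m₁ * m₂ + 2 * w ^ 2 * a * b := by
    rw [hw, hm₁, hm₂]; linear_combination -s₂ * hS
  have hs₃ : s₃ = m₂ ^ 2 - w ^ 2 * a ^ 2 := by
    rw [hw, hm₂]; linear_combination -s₃ * hS
  -- The values at `(a, b)` of `g` and of its derivative along `(-m₂, m₁)`.
  have hg : g₁ * a ^ 2 + g₂ * a * b + g₃ * b ^ 2 =
      (b * m₁ - a * m₂) / 2 + d * (a ^ 2 + b ^ 2) / 2 := by
    linear_combination m₂ / 2 * h1 - m₁ / 2 * h2 -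
      (g₁ * a ^ 2 + g₂ * a * b + g₃ * b ^ 2 - d * (a ^ 2 + b ^ 2) / 2) * hm
  have hw' : s₃ * m₁ ^ 2 - s₂ * m₁ * m₂ + s₁ * m₂ ^ 2 = -w ^ 2 := by
    rw [hs₁, hs₂, hs₃]; linear_combination -w ^ 2 * (a * m₁ + b * m₂ + 1) * hm
  have hp₁ : 2 * g₁ * a + g₂ * b = d * a + ((a ^ 2 + b ^ 2) * s₁ * m₂ + 2 * m₁ ^ 2 * b -
      2 * m₁ * m₂ * a - (a ^ 2 + b ^ 2) / 2 * s₂ * m₁ - (b * m₁ - a * m₂) * m₁ - m₂) / 2 := by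
    linear_combination -(m₂ * h3 - m₁ * h6) / 2 + (d * a - (2 * g₁ * a + g₂ * b)) * hm - m₁ * hg
  have hp₂ : g₂ * a + 2 * g₃ * b = d * b + (-(a ^ 2 + b ^ 2) * s₃ * m₁ + 2 * m₁ * m₂ * b -
      2 * m₂ ^ 2 * a + (a ^ 2 + b ^ 2) / 2 * s₂ * m₂ - (b * m₁ - a * m₂) * m₂ + m₁) / 2 := by
    linear_combination -(m₂ * h5 - m₁ * h4) / 2 + (d * b - (g₂ * a + 2 * g₃ * b)) * hm - m₂ * hg
  have hg' : m₁ * (g₂ * a + 2 * g₃ * b) - m₂ * (2 * g₁ * a + g₂ * b) =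
      (m₁ ^ 2 + m₂ ^ 2) / 2 + (a ^ 2 + b ^ 2) / 2 * w ^ 2 + d * (b * m₁ - a * m₂) := by
    rw [hp₁, hp₂]; linear_combination -(a ^ 2 + b ^ 2) / 2 * hw'
  refine ⟨m₁, m₂, w, g₁ * m₂ ^ 2 - g₂ * m₁ * m₂ + g₃ * m₁ ^ 2, hm, ?_⟩
  have hm2 : (a * m₁ + b * m₂) ^ 2 = 1 := by rw [hm, one_pow]
  ext <;> simp only [offLines, ← hg, ← hg']
  · exact hs₁
  · exact hs₂
  · exact hs₃
  · linear_combination -g₁ * hm2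
  · linear_combination -g₂ * hm2
  · linear_combination -g₃ * hm2

/-- A form whose two lines avoid the origin is in the closure: after scaling `S`, it is one of the
forms `Radial.offLines`. -/
theorem mem_closure_of_S₀_ne_zero {r : Radial} (hr : r.form ∈ poincare 3) (hS : r.S₀ ≠ 0) :
    r.form ∈ closure211 := by
  rw [← r.form_scale hS] at hr ⊢
  obtain ⟨m₁, m₂, w, γ, h, e⟩ := exists_eq_offLines hr
    (by
      generalize hμ : r.S₀ = μ at hS
      rw [S₀] at hμ ⊢
      simp only
      field_simp
      linear_combination hμ)
  rw [e]
  exact offLines_mem_closure h ..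

/-! ### Forms with one of the two lines through the origin -/

/-- The Poincaré forms with residues `1`, `1`, `-3` along a conic and a line through the origin and
a second line. The first line is isotropic, `x + qy = 0` with `q² = -1`, and the conic is tangent
to `x - qy = 0` at the origin. The second line `u(x - a) + v(y - qa) = 0` and three coefficients of
the conic are arbitrary. -/
def onLine (a q u v h₁ h₂ h₃ : ℂ) : Radial :=
  ofLog a (q * a) 1 q u v h₁ h₂ h₃
    (-1 / (2 * a * (u + q * v)) + u / (a * (u + q * v) ^ 2) + h₂ * (a * (u + q * v)))
    (-1 / (a * (u + q * v) ^ 2) + 2 * h₃ * (a * (u + q * v)))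
    (1 / (u + q * v) - h₃ * (a * (u + q * v)) ^ 2) (-2)

theorem onLine_mem_poincare {a q u v : ℂ} (ha : a ≠ 0) (hq : q ^ 2 = -1) (he : u + q * v ≠ 0)
    (h₁ h₂ h₃ : ℂ) : (onLine a q u v h₁ h₂ h₃).form ∈ poincare 3 := by
  rw [form_mem_poincare_iff]
  simp only [onLine, ofLog]
  obtain ⟨e, rfl⟩ : ∃ e, u = e - q * v := ⟨u + q * v, by ring⟩
  rw [sub_add_cancel] at he ⊢
  refine ⟨?_, ?_, ?_, ?_, ?_, ?_⟩ <;> field_simp <;> grind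

theorem exists_eq_onLine {r : Radial} (hr : r.form ∈ poincare 3) (hS : r.S₀ = 0)
    (hab : ¬(r.a = 0 ∧ r.b = 0)) :
    ∃ a q u v h₁ h₂ h₃ : ℂ, a ≠ 0 ∧ q ^ 2 = -1 ∧ u + q * v ≠ 0 ∧
      r = onLine a q u v h₁ h₂ h₃ := by
  obtain ⟨h1, h2, h3, h4, h5, h6⟩ := r.form_mem_poincare_iff.1 hr
  rw [S₀] at hS
  obtain ⟨a, b, s₁, s₂, s₃, l₀, l₁, l₂, g₁, g₂, g₃, d⟩ := r
  simp only at h1 h2 h3 h4 h5 h6 hS hab ⊢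
  rw [hS, zero_mul, zero_add] at h1 h2
  have k₁ : -2 * l₀ * (2 * s₁ * a + s₂ * b) +
      b * (l₁ * (s₂ * a + 2 * s₃ * b) - l₂ * (2 * s₁ * a + s₂ * b)) = a := by
    linear_combination a * h3 + b * h6 - h1
  have k₂ : -2 * l₀ * (s₂ * a + 2 * s₃ * b) -
      a * (l₁ * (s₂ * a + 2 * s₃ * b) - l₂ * (2 * s₁ * a + s₂ * b)) = b := by
    linear_combination a * h5 + b * h4 - h2
  -- The line through the origin is isotropic.
  have hiso : a ^ 2 + b ^ 2 = 0 := by linear_combination -a * k₁ - b * k₂ - 4 * l₀ * hS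
  have ha : a ≠ 0 := fun h => hab ⟨h, by simpa [h] using hiso⟩
  obtain ⟨q, rfl⟩ : ∃ q, b = q * a := ⟨b / a, by field_simp⟩
  have ha2 : a ^ 2 ≠ 0 := pow_ne_zero 2 ha
  have hq : q ^ 2 = -1 := by
    apply mul_left_cancel₀ ha2; linear_combination hiso
  have hs₂ : s₂ = q * (s₁ - s₃) := by
    apply mul_left_cancel₀ ha2; linear_combination -q * hS + a ^ 2 * (s₂ + s₃ * q) * hq
  obtain ⟨e, he⟩ : ∃ e, e = s₁ + s₃ := ⟨_, rfl⟩
  have q₁ : 2 * s₁ * a + s₂ * (q * a) = a * e := by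
    rw [hs₂, he]; linear_combination a * (s₁ - s₃) * hq
  have q₂ : s₂ * a + 2 * s₃ * (q * a) = q * (a * e) := by
    rw [hs₂, he]; ring
  rw [q₁, q₂] at k₁ k₂ h5 h6
  rw [q₁] at h1
  have hl : e * (2 * l₀ + a * l₁ + q * a * l₂) = -1 := by
    apply mul_left_cancel₀ ha; linear_combination -k₁ + a ^ 2 * e * l₁ * hq
  have he0 : e ≠ 0 := by rintro rfl; simp at hl
  have hl' : l₀ = -(1 / e + a * l₁ + q * a * l₂) / 2 := by
    field_simp
    linear_combination hl
  -- The values at `(a, qa)` of `g` and of its derivatives.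
  have hN : a ^ 2 * (g₁ + q * g₂ - g₃) + d * l₀ = q * l₀ * e / 2 := by
    apply mul_left_cancel₀ ha
    linear_combination -q / 2 * h1 +
      (a ^ 3 * (g₁ + q * g₂ + g₃ * (q ^ 2 - 1)) + a * d * l₀) * hq
  have hd : d = q * e := by
    linear_combination d * hl + e * (q / 2 * (h3 + h4) - 2 * hN - l₀ * q * he -
      (a * (d * l₁ - (2 * g₁ * a + g₂ * (q * a))) + 2 * a ^ 2 * g₃) * hq)
  subst hd
  have hγ₁ : 2 * g₁ * a + g₂ * (q * a) = q * e * l₁ + q * (1 + 2 * l₀ * s₁) / (2 * a) := by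
    field_simp
    linear_combination q * h3 - 2 * a * (q * e * l₁ - (2 * g₁ * a + g₂ * (q * a))) * hq
  have hγ₂ : g₂ * a + 2 * g₃ * (q * a) = q * e * l₂ + (1 + 2 * l₀ * s₃) / (2 * a) := by
    field_simp
    linear_combination h4
  have hN' : g₁ + q * g₂ - g₃ = -(q * l₀ * e) / (2 * a ^ 2) := by
    field_simp
    linear_combination 2 * hN
  have hM : -2 * s₃ * g₁ + q * (s₁ - s₃) * g₂ - 2 * s₁ * g₃ =
      (-s₃ * (q * e * l₁ + q * (1 + 2 * l₀ * s₁) / (2 * a)) +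
        q * s₁ * (q * e * l₂ + (1 + 2 * l₀ * s₃) / (2 * a))) / a := by
    rw [← hγ₁, ← hγ₂]
    field_simp
    linear_combination -2 * s₁ * g₃ * hq
  -- The conic is found by expanding `ℓ` and `g` in terms of the two lines.
  obtain ⟨c₁, hc₁⟩ : ∃ c₁, c₁ = 2 * q * (-s₃ ^ 2 * g₁ + q * s₁ * s₃ * g₂ + s₁ ^ 2 * g₃) /
    (3 * e ^ 3) := ⟨_, rfl⟩
  obtain ⟨c₂, hc₂⟩ : ∃ c₂, c₂ =
    ((s₃ * l₁ - q * s₁ * l₂) / e + 1 / (2 * a * e) - s₁ / (a * e ^ 2)) / (a * e) := ⟨_, rfl⟩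
  obtain ⟨c₃, hc₃⟩ : ∃ c₃, c₃ = ((q * l₂ + l₁) / e + 1 / (a * e ^ 2)) / (2 * a * e) := ⟨_, rfl⟩
  have hE₁ : -1 / (2 * a * e) + s₁ / (a * e ^ 2) + c₂ * (a * e) = (s₃ * l₁ - q * s₁ * l₂) / e := by
    rw [hc₂]; field_simp; ring
  have hE₂ : -1 / (a * e ^ 2) + 2 * c₃ * (a * e) = (q * l₂ + l₁) / e := by
    rw [hc₃]; field_simp; ring
  have t₁ : q * c₁ * (3 * e ^ 3) = -2 * (-s₃ ^ 2 * g₁ + q * s₁ * s₃ * g₂ + s₁ ^ 2 * g₃) := by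
    rw [hc₁, mul_assoc, div_mul_cancel₀ _ (by simpa using he0)]
    linear_combination 2 * (-s₃ ^ 2 * g₁ + q * s₁ * s₃ * g₂ + s₁ ^ 2 * g₃) * hq
  have t₂ : q * c₂ * e ^ 3 = -(-2 * s₃ * g₁ + q * (s₁ - s₃) * g₂ - 2 * s₁ * g₃) := by
    rw [hM, hc₂, hl']
    field_simp
    grind
  have t₃ : q * c₃ * e ^ 3 = 2 * (g₁ + q * g₂ - g₃) := by
    rw [hN', hc₃, hl']
    field_simp
    grind
  have he2 : e ^ 2 ≠ 0 := pow_ne_zero 2 he0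
  have hu : s₁ + q * (-q * s₃) = e := by linear_combination -s₃ * hq - he
  have hσ : 1 * (-q * s₃) - s₁ * q = -(q * e) := by rw [he]; ring
  have hL₁ : (s₃ * l₁ - q * s₁ * l₂) / e * 1 + (q * l₂ + l₁) / e * s₁ = l₁ := by
    field_simp
    linear_combination -l₁ * he
  have hL₂ : (s₃ * l₁ - q * s₁ * l₂) / e * q + (q * l₂ + l₁) / e * (-q * s₃) = l₂ := by
    field_simp
    linear_combination -(s₁ + s₃) * l₂ * hq - l₂ * he
  refine ⟨a, q, s₁, -q * s₃, c₁, c₂, c₃, ha, hq, hu ▸ he0, ?_⟩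
  ext <;> simp only [onLine, ofLog, hu, hσ, hE₁, hE₂, hL₁, hL₂]
  · ring
  · rw [hs₂]; ring
  · linear_combination s₃ * hq
  · rw [hl', hc₃]
    field_simp
    ring
  · apply mul_left_cancel₀ he2
    linear_combination g₁ * (e + s₁ + s₃) * he - t₁ / 2 - s₁ * t₂ - s₁ ^ 2 / 2 * t₃
  · apply mul_left_cancel₀ he2
    linear_combination g₂ * (e + s₁ + s₃) * he - q * t₁ - q * (s₁ - s₃) * t₂ +
      q * s₁ * s₃ * t₃ + (s₁ + s₃) ^ 2 * g₂ * hq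
  · apply mul_left_cancel₀ he2
    linear_combination g₃ * (e + s₁ + s₃) * he - q ^ 2 / 2 * t₁ + q ^ 2 * s₃ * t₂ -
      q ^ 2 * s₃ ^ 2 / 2 * t₃ + (s₁ + s₃) ^ 2 * g₃ * hq
  · ring

theorem onLine_mem_closure {a q u v : ℂ} (ha : a ≠ 0) (hq : q ^ 2 = -1) (he : u + q * v ≠ 0)
    (h₁ h₂ h₃ : ℂ) : (onLine a q u v h₁ h₂ h₃).form ∈ closure211 := by
  have hσ : 1 * v - u * q ≠ 0 := fun h => he (by linear_combination q * h + u * hq)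
  have hae : a * (u + q * v) ≠ 0 := mul_ne_zero ha he
  have hc₃ : ContinuousFamily fun t => onLine a q u v h₁ h₂ t := by
    constructor <;> simp only [onLine, ofLog] <;> fun_prop
  refine hc₃.mem_zariskiClosure (onLine_mem_poincare ha hq he ..) ?_
  filter_upwards [eventually_quadratic_ne_zero (p := 0) (.inr one_ne_zero) 0 h₃,
    eventually_quadratic_ne_zero (p := 0) (.inr (neg_ne_zero.2 (pow_ne_zero 2 hae)))
      (1 / (u + q * v)) h₃] with t ht ht'
  have hc₁ : ContinuousFamily fun s => onLine a q u v s h₂ t := by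
    constructor <;> simp only [onLine, ofLog] <;> fun_prop
  refine hc₁.mem_zariskiClosure (onLine_mem_poincare ha hq he ..) ?_
  filter_upwards [eventually_genericConic_left (h₃ := t)
    (e₂ := -1 / (a * (u + q * v) ^ 2) + 2 * t * (a * (u + q * v)))
    (c := 1 / (u + q * v) - t * (a * (u + q * v)) ^ 2)
    (fun h => ht' (by linear_combination h)) (fun h => ht (by linear_combination h))
    (by
      -- The conic meets the first line transversally at the origin, hence is nowhere tangent to it.
      rw [show 4 * (1 / (u + q * v) - t * (a * (u + q * v)) ^ 2) * t +
        (-1 / (a * (u + q * v) ^ 2) + 2 * t * (a * (u + q * v))) ^ 2 =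
          (1 / (a * (u + q * v) ^ 2)) ^ 2 by field_simp; ring]
      exact pow_ne_zero 2 (one_div_ne_zero (mul_ne_zero ha (pow_ne_zero 2 he))))
    h₂ (-1 / (2 * a * (u + q * v)) + u / (a * (u + q * v) ^ 2) + h₂ * (a * (u + q * v))) h₁]
    with s hs
  exact subset_zariskiClosure Set.inter_subset_right
    ⟨ofLog_mem_YDarboux hσ hs .., onLine_mem_poincare ha hq he ..⟩

/-- A singular point that is not the common point of the two lines is either off the lines or on
exactly one of them. -/
theorem mem_closure_of_ne {r : Radial} (hr : r.form ∈ poincare 3)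
    (hab : ¬(r.a = 0 ∧ r.b = 0)) : r.form ∈ closure211 := by
  by_cases hS : r.S₀ = 0
  · obtain ⟨a, q, u, v, h₁, h₂, h₃, ha, hq, he, e⟩ := exists_eq_onLine hr hS hab
    rw [e]
    exact onLine_mem_closure ha hq he ..
  · exact mem_closure_of_S₀_ne_zero hr hS

end Radial

/-! ### The common point of the two lines at the origin -/

namespace Radial

/-- If both lines pass through the origin, the linear part of a Poincaré form is `-ℓ(O) dS` up to a
multiple of `x dy - y dx`, so that `S` is a multiple of `x² + y²` and they are isotropic. -/
theorem data_of_node {r : Radial} (hr : r.form ∈ poincare 3) (ha : r.a = 0) (hb : r.b = 0) :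
    -2 * r.l₀ * r.s₁ = 1 ∧ r.s₂ = 0 ∧ r.s₃ = r.s₁ ∧ r.d = 0 := by
  obtain ⟨-, -, h3, h4, h5, h6⟩ := r.form_mem_poincare_iff.1 hr
  rw [ha, hb] at h3 h4 h5 h6
  have h1 : -2 * r.l₀ * r.s₁ = 1 := by linear_combination h3
  have hl : r.l₀ ≠ 0 := by
    intro h
    simp [h] at h1
  refine ⟨h1, ?_, ?_, ?_⟩ <;> apply mul_left_cancel₀ hl
  · linear_combination -h5 / 2 - h6 / 2
  · linear_combination h3 / 2 - h4 / 2
  · linear_combination h6 / 4 - h5 / 4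

/-- If the binary form `g` is apolar to `x² + y²`, then the form is `S dF - F dS` for a conic `F`
that may be changed by any multiple of `S`. -/
theorem mem_closure_of_node {r : Radial} (hr : r.form ∈ poincare 3) (ha : r.a = 0) (hb : r.b = 0)
    (hg : r.g₁ + r.g₃ = 0) : r.form ∈ closure211 := by
  obtain ⟨h1, h2, h3, h4⟩ := data_of_node hr ha hb
  obtain ⟨a, b, s₁, s₂, s, l₀, l₁, l₂, g₁, g₂, g₃, d⟩ := r
  simp only at h1 h2 h3 h4 ha hb hg
  subst ha hb h2 h3 h4
  obtain rfl : g₃ = -g₁ := by linear_combination hg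
  have hl : l₀ ≠ 0 := by
    rintro rfl
    simp at h1
  have hs : s ≠ 0 := by
    rintro rfl
    simp at h1
  have hI : Complex.I ^ 2 = -1 := Complex.I_sq
  have hI0 : Complex.I ≠ 0 := Complex.I_ne_zero
  set r₀ : ℂ → ℂ → ℂ → Radial := fun h₁ h₂ h₃ => ofLog 0 0 1 Complex.I s (-s * Complex.I) h₁ h₂ h₃
    ((l₁ - Complex.I * l₂) / 2) ((l₁ + Complex.I * l₂) / (2 * s)) (-l₀) 0 with hr₀
  have hP (h₁ h₂ h₃ : ℂ) : (r₀ h₁ h₂ h₃).form ∈ poincare 3 := by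
    rw [form_mem_poincare_iff]
    simp only [hr₀, ofLog]
    refine ⟨?_, ?_, ?_, ?_, ?_, ?_⟩
    · ring
    · ring
    · linear_combination h1
    · linear_combination h1 + 2 * l₀ * s * hI
    · ring
    · ring
  set e₁ : ℂ := (-Complex.I * g₁ - g₂ / 2) / (2 * s) with he₁
  set e₃ : ℂ := (Complex.I * g₁ - g₂ / 2) / (2 * s ^ 3) with he₃
  have hc : ContinuousFamily fun t => r₀ (1 * t + e₁) (0 * t + 0) (1 * t + e₃) := by
    constructor <;> simp only [hr₀, ofLog] <;> fun_prop
  have key := hc.mem_zariskiClosure (t₀ := 0) (T := XDarboux 3 ![2, 1, 1]) (hP ..) ?_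
  · convert key using 2
    simp only [hr₀, ofLog]
    ext <;> simp only
    · ring
    · ring
    · linear_combination s * hI
    · ring
    · field_simp
      ring
    · field_simp
      linear_combination 2 * l₂ * hI
    · rw [he₁, he₃]
      field_simp
      linear_combination 8 * g₁ * hI
    · rw [he₁, he₃]
      field_simp
      linear_combination 4 * g₂ * hI
    · rw [he₁, he₃]
      field_simp
      linear_combination (8 * Complex.I ^ 2 - 8) * g₁ * hI
    · ring
  · filter_upwards [eventually_genericConic (c := -l₀) (neg_ne_zero.2 hl) one_ne_zero one_ne_zero
      (p₂ := 0) (by norm_num) e₁ 0 e₃ ((l₁ - Complex.I * l₂) / 2)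
      ((l₁ + Complex.I * l₂) / (2 * s)) 0] with t ht
    refine subset_zariskiClosure Set.inter_subset_right ⟨ofLog_mem_YDarboux ?_ ht .., hP ..⟩
    rw [show 1 * (-s * Complex.I) - s * Complex.I = -2 * s * Complex.I by ring]
    exact mul_ne_zero (mul_ne_zero (by norm_num) hs) hI0

/-- The exponent of the monomial `xⁱyʲ`. -/
def expo (i j : ℕ) : Fin 2 →₀ ℕ := Finsupp.single 0 i + Finsupp.single 1 j

theorem coeff_expo_pderiv_zero (i j : ℕ) (F : MvPowerSeries (Fin 2) ℂ) :
    MvPowerSeries.coeff (expo i j) (MvPowerSeries.pderiv ℂ 0 F) =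
      MvPowerSeries.coeff (expo (i + 1) j) F * (i + 1) := by
  rw [MvPowerSeries.coeff_pderiv]
  congr 2
  · simp only [expo, Finsupp.single_add]; abel_nf
  · simp [expo]

theorem coeff_expo_pderiv_one (i j : ℕ) (F : MvPowerSeries (Fin 2) ℂ) :
    MvPowerSeries.coeff (expo i j) (MvPowerSeries.pderiv ℂ 1 F) =
      MvPowerSeries.coeff (expo i (j + 1)) F * (j + 1) := by
  rw [MvPowerSeries.coeff_pderiv]
  congr 2
  · simp only [expo, Finsupp.single_add]; abel_nf
  · simp [expo]

theorem coeff_expo_mul_monomial (i j p q : ℕ) (c : ℂ) (F : MvPowerSeries (Fin 2) ℂ) :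
    MvPowerSeries.coeff (expo i j) (F * MvPowerSeries.monomial (expo p q) c) =
      if p ≤ i ∧ q ≤ j then MvPowerSeries.coeff (expo (i - p) (j - q)) F * c else 0 := by
  classical
  rw [MvPowerSeries.coeff_mul_monomial]
  have h1 : expo p q ≤ expo i j ↔ p ≤ i ∧ q ≤ j := by
    simp [Finsupp.le_def, expo, Fin.forall_fin_two]
  have h2 : expo i j - expo p q = expo (i - p) (j - q) := by
    ext k; fin_cases k <;> simp [expo]
  rw [h2]
  simp only [h1]

theorem monomial_expo (i j : ℕ) (c : ℂ) : MvPowerSeries.monomial (expo i j) c =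
    ((C c * MvPolynomial.X 0 ^ i * MvPolynomial.X 1 ^ j : MvPolynomial (Fin 2) ℂ) :
      MvPowerSeries (Fin 2) ℂ) := by
  rw [← MvPolynomial.coe_monomial]
  congr 1
  rw [expo, monomial_add_single, ← C_mul_X_pow_eq_monomial]

theorem expo_inj {i j p q : ℕ} : expo i j = expo p q ↔ i = p ∧ j = q := by
  constructor
  · intro h
    have h0 := DFunLike.congr_fun h 0
    have h1 := DFunLike.congr_fun h 1
    simpa [expo] using And.intro h0 h1
  · rintro ⟨rfl, rfl⟩; rfl

theorem _root_.PlaneForm.StartsWithCircle.coeff_expo {F : MvPowerSeries (Fin 2) ℂ}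
    (hF : StartsWithCircle F) {i j : ℕ} (h : i + j < 3) : MvPowerSeries.coeff (expo i j) F =
      (if 2 = i ∧ 0 = j then 1 else 0) + (if 0 = i ∧ 2 = j then 1 else 0) := by
  have e := hF (expo i j) (by simpa [expo] using h)
  have h0 : (MvPolynomial.X 0 ^ 2 : MvPolynomial (Fin 2) ℂ) = monomial (expo 2 0) 1 := by
    simp [expo, X_pow_eq_monomial]
  have h1 : (MvPolynomial.X 1 ^ 2 : MvPolynomial (Fin 2) ℂ) = monomial (expo 0 2) 1 := by
    simp [expo, X_pow_eq_monomial]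
  rw [e, h0, h1, coeff_add, coeff_monomial, coeff_monomial]
  simp only [expo_inj]

/-- The first focal value: for a Poincaré form `S dℓ - ℓ dS + 2g(x dy - y dx)` it is a multiple of
`g₁ + g₃`. -/
theorem apolar_of_mem_centerVariety {r : Radial} (hr : r.form ∈ centerVariety 3) (ha : r.a = 0)
    (hb : r.b = 0) : r.g₁ + r.g₃ = 0 := by
  obtain ⟨hr, F, hF, h⟩ := hr
  obtain ⟨h1, h2, h3, h4⟩ := data_of_node hr ha hb
  clear hr
  obtain ⟨a, b, s₁, s₂, s, l₀, l₁, l₂, g₁, g₂, g₃, d⟩ := r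
  simp only at h1 h2 h3 h4 ha hb ⊢
  subst ha hb h2 h3 h4
  have hP : dehom (form ⟨0, 0, s, 0, s, l₀, l₁, l₂, g₁, g₂, g₃, 0⟩).P =
      MvPowerSeries.monomial (expo 1 0) (1 : ℂ) +
      MvPowerSeries.monomial (expo 2 0) (-(s * l₁)) +
      MvPowerSeries.monomial (expo 1 1) (-2 * s * l₂) +
      MvPowerSeries.monomial (expo 0 2) (s * l₁) +
      MvPowerSeries.monomial (expo 2 1) (-2 * g₁) +
      MvPowerSeries.monomial (expo 1 2) (-2 * g₂) +
      MvPowerSeries.monomial (expo 0 3) (-2 * g₃) := by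
    rw [← h1]
    simp only [monomial_expo, ← coe_add, dehom]
    congr 1
    simp only [form, S, X, Y, ell, G, map_add, map_sub, map_mul, aeval_X, aeval_C,
      algebraMap_eq, map_zero, Matrix.cons_val_zero, Matrix.cons_val_one, Matrix.cons_val,
      map_neg, map_ofNat]
    ring
  have hQ : dehom (form ⟨0, 0, s, 0, s, l₀, l₁, l₂, g₁, g₂, g₃, 0⟩).Q =
      MvPowerSeries.monomial (expo 0 1) (1 : ℂ) +
      MvPowerSeries.monomial (expo 2 0) (s * l₂) +
      MvPowerSeries.monomial (expo 1 1) (-2 * s * l₁) +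
      MvPowerSeries.monomial (expo 0 2) (-(s * l₂)) +
      MvPowerSeries.monomial (expo 3 0) (2 * g₁) +
      MvPowerSeries.monomial (expo 2 1) (2 * g₂) +
      MvPowerSeries.monomial (expo 1 2) (2 * g₃) := by
    rw [← h1]
    simp only [monomial_expo, ← coe_add, dehom]
    congr 1
    simp only [form, S, X, Y, ell, G, map_add, map_sub, map_mul, aeval_X, aeval_C,
      algebraMap_eq, map_zero, Matrix.cons_val_zero, Matrix.cons_val_one, Matrix.cons_val,
      map_neg, map_ofNat]
    ring
  rw [hP, hQ] at h
  have key (i j : ℕ) := congrArg (MvPowerSeries.coeff (expo i j)) h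
  simp only [mul_add, map_sub, map_add, coeff_expo_mul_monomial, coeff_expo_pderiv_zero,
    coeff_expo_pderiv_one, map_zero] at key
  have c20 := hF.coeff_expo (i := 2) (j := 0) (by norm_num)
  have c11 := hF.coeff_expo (i := 1) (j := 1) (by norm_num)
  have c02 := hF.coeff_expo (i := 0) (j := 2) (by norm_num)
  have c10 := hF.coeff_expo (i := 1) (j := 0) (by norm_num)
  have c01 := hF.coeff_expo (i := 0) (j := 1) (by norm_num)
  norm_num at c20 c11 c02 c10 c01
  have k30 := key 3 0
  have k21 := key 2 1
  have k12 := key 1 2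
  have k03 := key 0 3
  have k40 := key 4 0
  have k22 := key 2 2
  have k04 := key 0 4
  norm_num [c20, c11, c02, c10, c01] at k30 k21 k12 k03 k40 k22 k04
  -- Degree three determines the cubic part of `F`; then `3x⁴ + x²y² + 3y⁴` is the combination of
  -- coefficients of degree four from which the quartic part of `F` drops out.
  have f21 : MvPowerSeries.coeff (expo 2 1) F = 2 * s * l₂ := by linear_combination -k30
  have f12 : MvPowerSeries.coeff (expo 1 2) F = 2 * s * l₁ := by linear_combination k03
  rw [f12] at k21
  rw [f21] at k12
  have f30 : MvPowerSeries.coeff (expo 3 0) F = 2 * s * l₁ := by linear_combination k21 / 3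
  have f03 : MvPowerSeries.coeff (expo 0 3) F = 2 * s * l₂ := by linear_combination -k12 / 3
  rw [f21, f12, f30, f03] at k22
  rw [f21, f30] at k40
  rw [f12, f03] at k04
  linear_combination (3 * k40 + k22 + 3 * k04) / 16

end Radial

/-! ### The family `CR₁₂` in radial shape -/

/-- With `S = ky² + qyT + rT²`, `g = ly² + nyT + pT²` the form with parameters `t` is
`S dx - x dS + 2(g + (m - q/2)x)(y dT - T dy)`. Its pull-back has the same shape, in the linear
coordinates centred at the preimage `(a, b)` of the point `y = T = 0`. -/
theorem exists_radial_of_pullback (t : Param) (φ : AffineChange) :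
    ∃ r : Radial, r.form = φ.pullback t.form ∧ (r.a = 0 ∧ r.b = 0 → φ.tr = ![-t.c, 0]) := by
  have hdet := φ.det_ne_zero
  rw [Matrix.det_fin_two] at hdet
  obtain ⟨c, k, l, m, n, p, q, r⟩ := t
  obtain ⟨A, hA⟩ : ∃ A, A = φ.lin 0 0 := ⟨_, rfl⟩
  obtain ⟨B, hB⟩ : ∃ B, B = φ.lin 0 1 := ⟨_, rfl⟩
  obtain ⟨A', hA'⟩ : ∃ A', A' = φ.lin 1 0 := ⟨_, rfl⟩
  obtain ⟨B', hB'⟩ : ∃ B', B' = φ.lin 1 1 := ⟨_, rfl⟩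
  rw [← hA, ← hB, ← hA', ← hB'] at hdet
  obtain ⟨a, ha⟩ : ∃ a, a = (-(φ.tr 0 + c) * B' + B * φ.tr 1) / (A * B' - B * A') := ⟨_, rfl⟩
  obtain ⟨b, hb⟩ : ∃ b, b = (-A * φ.tr 1 + A' * (φ.tr 0 + c)) / (A * B' - B * A') := ⟨_, rfl⟩
  rw [eq_div_iff hdet] at ha hb
  have h0 : φ.tr 0 = -(A * a + B * b) - c := by
    apply mul_left_cancel₀ hdet
    linear_combination A * ha + B * hb
  have h1 : φ.tr 1 = -(A' * a + B' * b) := by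
    apply mul_left_cancel₀ hdet
    linear_combination A' * ha + B' * hb
  refine ⟨{
    a := a
    b := b
    s₁ := k * A' ^ 2 + q * A' * (A + A') + r * (A + A') ^ 2
    s₂ := 2 * k * A' * B' + q * (A' * (B + B') + B' * (A + A')) + 2 * r * (A + A') * (B + B')
    s₃ := k * B' ^ 2 + q * B' * (B + B') + r * (B + B') ^ 2
    l₀ := φ.tr 0
    l₁ := A
    l₂ := B
    g₁ := -(A * B' - B * A') * (l * A' ^ 2 + n * A' * (A + A') + p * (A + A') ^ 2)
    g₂ := -(A * B' - B * A') * (2 * l * A' * B' + n * (A' * (B + B') + B' * (A + A')) +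
      2 * p * (A + A') * (B + B'))
    g₃ := -(A * B' - B * A') * (l * B' ^ 2 + n * B' * (B + B') + p * (B + B') ^ 2)
    d := -(A * B' - B * A') * (m - q / 2) }, ?_, ?_⟩
  · ext1 <;> refine MvPolynomial.funext fun v => ?_ <;>
    · simp only [Radial.form, Radial.S, Radial.X, Radial.Y, Radial.ell, Radial.G, Param.form,
        Param.T, AffineChange.pullback, AffineChange.comp, map_add, map_sub, map_mul, map_pow,
        map_neg, aeval_X, aeval_C, algebraMap_eq, eval_C, eval_X, map_ofNat, ← hA, ← hB, ← hA',
        ← hB', h0, h1, Matrix.cons_val_zero, Matrix.cons_val_one, Matrix.cons_val]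
      ring
  · rintro ⟨rfl, rfl⟩
    ext i
    fin_cases i <;> simp [h0, h1]

theorem mem_closure_of_tr_ne {t : Param} {φ : AffineChange}
    (h : φ.pullback t.form ∈ poincare 3) (hφ : φ.tr ≠ ![-t.c, 0]) :
    φ.pullback t.form ∈ closure211 := by
  obtain ⟨r, hr, hr'⟩ := exists_radial_of_pullback t φ
  rw [← hr] at h ⊢
  exact Radial.mem_closure_of_ne h fun h0 => hφ (hr' h0)

theorem XCR12_inter_centerVariety_subset : XCR12 ∩ centerVariety 3 ⊆ closure211 := by
  rintro _ ⟨⟨⟨t, φ, rfl⟩, hP⟩, hc⟩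
  obtain ⟨r, hr, -⟩ := exists_radial_of_pullback t φ
  rw [← hr] at hP hc ⊢
  by_cases h : r.a = 0 ∧ r.b = 0
  · exact Radial.mem_closure_of_node hP h.1 h.2
      (Radial.apolar_of_mem_centerVariety hc h.1 h.2)
  · exact Radial.mem_closure_of_ne hP h

/-! ### The conic and the lines of a general member -/

namespace Param

/-- The determinant of twice the block of the linear system that belongs to the rows two to four
and the unknowns `a₂₀`, `a₁₁`, `a₀₂`. The parameters are numbered as in `Param.toFun`, and may lie
in any ring. -/
def blockDet {R : Type*} [CommRing R] (v : Fin 8 → R) : R :=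
  (-2 * v 3 - 2 * v 7) * ((-2 * v 3 + v 6 - 2 * v 7) * (2 * (v 6 - v 3)) -
    2 * v 7 * (-v 1 + 2 * v 3 - 2 * v 6)) -
  v 7 * (2 * (-v 1 + 2 * v 3 - v 6 + v 7) * (2 * (v 6 - v 3)) -
    2 * v 7 * (2 * (v 1 - v 3 + v 6)))

/-- The coefficient `a₂₀` of the conic, by Cramer's rule. -/
def coeff₀ {R : Type*} [CommRing R] (v : Fin 8 → R) : R :=
  -2 * (((-2 * v 3 + v 6 - 2 * v 7) * (2 * (v 6 - v 3)) -
      2 * v 7 * (-v 1 + 2 * v 3 - 2 * v 6)) * v 5 -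
    v 7 * (2 * (v 6 - v 3)) * v 4 + v 7 * (2 * v 7) * v 2)

/-- The coefficient `a₁₁` of the conic, by Cramer's rule. -/
def coeff₁ {R : Type*} [CommRing R] (v : Fin 8 → R) : R :=
  -2 * (-(2 * (-v 1 + 2 * v 3 - v 6 + v 7) * (2 * (v 6 - v 3)) -
      2 * v 7 * (2 * (v 1 - v 3 + v 6))) * v 5 +
    (-2 * v 3 - 2 * v 7) * (2 * (v 6 - v 3)) * v 4 - (-2 * v 3 - 2 * v 7) * (2 * v 7) * v 2)

/-- The coefficient `a₀₂` of the conic, by Cramer's rule. -/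
def coeff₂ {R : Type*} [CommRing R] (v : Fin 8 → R) : R :=
  -2 * ((2 * (-v 1 + 2 * v 3 - v 6 + v 7) * (-v 1 + 2 * v 3 - 2 * v 6) -
      (-2 * v 3 + v 6 - 2 * v 7) * (2 * (v 1 - v 3 + v 6))) * v 5 -
    ((-2 * v 3 - 2 * v 7) * (-v 1 + 2 * v 3 - 2 * v 6) - v 7 * (2 * (v 1 - v 3 + v 6))) * v 4 +
    ((-2 * v 3 - 2 * v 7) * (-2 * v 3 + v 6 - 2 * v 7) -
      v 7 * (2 * (-v 1 + 2 * v 3 - v 6 + v 7))) * v 2)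

/-- The quantity whose vanishing `isSmoothCurve_lineConic` excludes, for the conic with coefficients
given by Cramer's rule, divided by the square of `Param.blockDet`. -/
def conicDisc {R : Type*} [CommRing R] (v : Fin 8 → R) : R :=
  (4 * v 0 * (coeff₁ v - 2 * coeff₀ v) - 2 * blockDet v) ^ 2 -
    4 * (4 * v 0 * (coeff₀ v - coeff₁ v + coeff₂ v) + blockDet v) *
      (4 * v 0 * coeff₀ v + blockDet v)

/-- A member of the family is general if this polynomial does not vanish at its parameters. -/
def generic {R : Type*} [CommRing R] (v : Fin 8 → R) : R :=
  v 0 * v 1 * (v 6 ^ 2 - 4 * v 1 * v 7) * blockDet v * conicDisc v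

theorem eval_generic (v : Fin 8 → ℂ) :
    eval v (generic (MvPolynomial.X : Fin 8 → MvPolynomial (Fin 8) ℂ)) = generic v := by
  simp [generic, conicDisc, coeff₀, coeff₁, coeff₂, blockDet]

theorem generic_X_ne_zero : generic (MvPolynomial.X : Fin 8 → MvPolynomial (Fin 8) ℂ) ≠ 0 := by
  intro h
  have e := eval_generic ![1, 1, -1, 1, 1, 0, 0, 1]
  rw [h, map_zero] at e
  revert e
  simp only [generic, conicDisc, coeff₀, coeff₁, coeff₂, blockDet, Matrix.cons_val_zero,
    Matrix.cons_val_one, Matrix.cons_val]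
  norm_num

/-- The solution of the linear system given by Cramer's rule. -/
def conicSol (t : Param) : Fin 6 → ℂ :=
  ![coeff₀ t.toFun, coeff₁ t.toFun, coeff₂ t.toFun,
    blockDet t.toFun + 2 * t.c * coeff₀ t.toFun, t.c * coeff₁ t.toFun, t.c ^ 2 * coeff₀ t.toFun]

theorem mulVec_conicMatrix_eq_zero_iff (t : Param) (b : Fin 6 → ℂ) :
    t.conicMatrix.mulVec b = 0 ↔ b 4 = t.c * b 1 ∧ b 5 = t.c ^ 2 * b 0 ∧
      (-t.m - t.r) * b 0 + t.r / 2 * b 1 + t.p * (b 3 - 2 * t.c * b 0) = 0 ∧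
      (-t.k + 2 * t.m - t.q + t.r) * b 0 + (-t.m + t.q / 2 - t.r) * b 1 + t.r * b 2 +
        t.n * (b 3 - 2 * t.c * b 0) = 0 ∧
      (t.k - t.m + t.q) * b 0 + (-t.k / 2 + t.m - t.q) * b 1 + (-t.m + t.q) * b 2 +
        t.l * (b 3 - 2 * t.c * b 0) = 0 := by
  have e : t.conicMatrix.mulVec b = ![-(t.c * b 1) + b 4,
      (-2 * t.p * t.c - t.m - t.r) * b 0 + t.r / 2 * b 1 + t.p * b 3,
      (-2 * t.n * t.c - t.k + 2 * t.m - t.q + t.r) * b 0 + (-t.m + t.q / 2 - t.r) * b 1 +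
        t.r * b 2 + t.n * b 3,
      (-2 * t.l * t.c + t.k - t.m + t.q) * b 0 + (-t.k / 2 + t.m - t.q) * b 1 +
        (-t.m + t.q) * b 2 + t.l * b 3,
      -(t.c ^ 2 * b 0) + b 5] := by
    ext i
    fin_cases i <;>
      simp [conicMatrix, Matrix.mulVec, dotProduct, Fin.sum_univ_succ] <;> ring
  rw [e]
  constructor
  · intro h
    have h0 := congrFun h 0
    have h1 := congrFun h 1
    have h2 := congrFun h 2
    have h3 := congrFun h 3
    have h4 := congrFun h 4
    simp only [Matrix.cons_val_zero, Matrix.cons_val_one, Matrix.cons_val, Pi.zero_apply]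
      at h0 h1 h2 h3 h4
    refine ⟨?_, ?_, ?_, ?_, ?_⟩
    · linear_combination h0
    · linear_combination h4
    · linear_combination h1
    · linear_combination h2
    · linear_combination h3
  · rintro ⟨h0, h4, h1, h2, h3⟩
    ext i
    fin_cases i <;> simp only [Pi.zero_apply]
    · show -(t.c * b 1) + b 4 = 0
      linear_combination h0
    · show (-2 * t.p * t.c - t.m - t.r) * b 0 + t.r / 2 * b 1 + t.p * b 3 = 0
      linear_combination h1
    · show (-2 * t.n * t.c - t.k + 2 * t.m - t.q + t.r) * b 0 + (-t.m + t.q / 2 - t.r) * b 1 +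
        t.r * b 2 + t.n * b 3 = 0
      linear_combination h2
    · show (-2 * t.l * t.c + t.k - t.m + t.q) * b 0 + (-t.k / 2 + t.m - t.q) * b 1 +
        (-t.m + t.q) * b 2 + t.l * b 3 = 0
      linear_combination h3
    · show -(t.c ^ 2 * b 0) + b 5 = 0
      linear_combination h4

theorem mulVec_conicSol (t : Param) : t.conicMatrix.mulVec t.conicSol = 0 := by
  rw [mulVec_conicMatrix_eq_zero_iff]
  refine ⟨rfl, rfl, ?_, ?_, ?_⟩ <;>
  · simp only [conicSol, coeff₀, coeff₁, coeff₂, blockDet, toFun, Matrix.cons_val_zero,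
      Matrix.cons_val_one, Matrix.cons_val]
    ring

theorem mulVec_eq_zero_iff_exists_smul {t : Param} (h : blockDet t.toFun ≠ 0) (b : Fin 6 → ℂ) :
    t.conicMatrix.mulVec b = 0 ↔ ∃ s : ℂ, b = s • t.conicSol := by
  constructor
  · intro hb
    obtain ⟨h4, h5, h1, h2, h3⟩ := (t.mulVec_conicMatrix_eq_zero_iff b).1 hb
    have c0 : blockDet t.toFun * b 0 = (b 3 - 2 * t.c * b 0) * coeff₀ t.toFun := by
      simp only [coeff₀, blockDet, toFun, Matrix.cons_val_zero, Matrix.cons_val_one,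
        Matrix.cons_val]
      linear_combination
        2 * ((-2 * t.m + t.q - 2 * t.r) * (2 * (t.q - t.m)) -
          2 * t.r * (-t.k + 2 * t.m - 2 * t.q)) * h1 -
        2 * (t.r * (2 * (t.q - t.m))) * h2 + 2 * (t.r * (2 * t.r)) * h3
    have c1 : blockDet t.toFun * b 1 = (b 3 - 2 * t.c * b 0) * coeff₁ t.toFun := by
      simp only [coeff₁, blockDet, toFun, Matrix.cons_val_zero, Matrix.cons_val_one,
        Matrix.cons_val]
      linear_combination
        -2 * (2 * (-t.k + 2 * t.m - t.q + t.r) * (2 * (t.q - t.m)) -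
          2 * t.r * (2 * (t.k - t.m + t.q))) * h1 +
        2 * ((-2 * t.m - 2 * t.r) * (2 * (t.q - t.m))) * h2 -
        2 * ((-2 * t.m - 2 * t.r) * (2 * t.r)) * h3
    have c2 : blockDet t.toFun * b 2 = (b 3 - 2 * t.c * b 0) * coeff₂ t.toFun := by
      simp only [coeff₂, blockDet, toFun, Matrix.cons_val_zero, Matrix.cons_val_one,
        Matrix.cons_val]
      linear_combination
        2 * (2 * (-t.k + 2 * t.m - t.q + t.r) * (-t.k + 2 * t.m - 2 * t.q) -
          (-2 * t.m + t.q - 2 * t.r) * (2 * (t.k - t.m + t.q))) * h1 -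
        2 * ((-2 * t.m - 2 * t.r) * (-t.k + 2 * t.m - 2 * t.q) -
          t.r * (2 * (t.k - t.m + t.q))) * h2 +
        2 * ((-2 * t.m - 2 * t.r) * (-2 * t.m + t.q - 2 * t.r) -
          t.r * (2 * (-t.k + 2 * t.m - t.q + t.r))) * h3
    refine ⟨(b 3 - 2 * t.c * b 0) / blockDet t.toFun, ?_⟩
    have e0 : b 0 = (b 3 - 2 * t.c * b 0) / blockDet t.toFun * coeff₀ t.toFun := by
      rw [div_mul_eq_mul_div, eq_div_iff h, ← c0, mul_comm]
    have e1 : b 1 = (b 3 - 2 * t.c * b 0) / blockDet t.toFun * coeff₁ t.toFun := by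
      rw [div_mul_eq_mul_div, eq_div_iff h, ← c1, mul_comm]
    have e2 : b 2 = (b 3 - 2 * t.c * b 0) / blockDet t.toFun * coeff₂ t.toFun := by
      rw [div_mul_eq_mul_div, eq_div_iff h, ← c2, mul_comm]
    have e3 := div_mul_cancel₀ (b 3 - 2 * t.c * b 0) h
    generalize (b 3 - 2 * t.c * b 0) / blockDet t.toFun = s at *
    ext i
    fin_cases i
    · exact e0
    · exact e1
    · exact e2
    · show b 3 = s * (blockDet t.toFun + 2 * t.c * coeff₀ t.toFun)
      linear_combination 2 * t.c * e0 - e3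
    · show b 4 = s * (t.c * coeff₁ t.toFun)
      linear_combination h4 + t.c * e1
    · show b 5 = s * (t.c ^ 2 * coeff₀ t.toFun)
      linear_combination h5 + t.c ^ 2 * e0
  · rintro ⟨s, rfl⟩
    rw [Matrix.mulVec_smul, mulVec_conicSol, smul_zero]

/-- In the coordinates `y` and `T` the conic is the sum of a binary quadratic form and a multiple
of `x = T - y - c`. -/
theorem conic_eq_lineConic (t : Param) {a : Fin 6 → ℂ} (h4 : a 4 = t.c * a 1)
    (h5 : a 5 = t.c ^ 2 * a 0) :
    conic a = lineConic (line 0 1 0) (line 1 1 t.c) (a 0 - a 1 + a 2) (a 1 - 2 * a 0) (a 0)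
      (-(a 3 - 2 * t.c * a 0)) (a 3 - 2 * t.c * a 0) ((a 3 - 2 * t.c * a 0) * t.c) := by
  refine MvPolynomial.funext fun v => ?_
  simp only [conic, eval_lineConic, eval_line, map_add, map_mul, map_pow, eval_C, eval_X, h4, h5]
  ring

/-- The rows two to four of the linear system say that the form is logarithmic along the conic and
the lines `ky + AT = 0`, `y + BT = 0`, where `A + kB = q` and `AB = r`. -/
theorem form_eq_logForm (t : Param) {a : Fin 6 → ℂ} {A B κ : ℂ} (ha : t.conicMatrix.mulVec a = 0)
    (hβ : a 3 - 2 * t.c * a 0 ≠ 0) (hq : t.q = A + t.k * B) (hr : t.r = A * B)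
    (hm : t.m = (A + t.k * B - κ * (A - t.k * B)) / 2) :
    t.form = logForm (1 / (a 3 - 2 * t.c * a 0)) ((-1 - κ) / (a 3 - 2 * t.c * a 0))
      ((-1 + κ) / (a 3 - 2 * t.c * a 0)) (conic a)
      (line A (t.k + A) (t.c * A)) (line B (1 + B) (t.c * B)) := by
  obtain ⟨h4, h5, h1, h2, h3⟩ := (t.mulVec_conicMatrix_eq_zero_iff a).1 ha
  obtain ⟨β, hβ'⟩ : ∃ β, β = a 3 - 2 * t.c * a 0 := ⟨_, rfl⟩
  rw [← hβ'] at hβ h1 h2 h3 ⊢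
  obtain h6 : a 3 = β + 2 * t.c * a 0 := by linear_combination -hβ'
  obtain ⟨c, k, l, m, n, p, q, r⟩ := t
  simp only at h1 h2 h3 h4 h5 h6 hq hr hm ⊢
  subst hq hr hm
  have hg₁ (v : Fin 3 → ℂ) (j : Fin 3) :=
    congrFun (grad_line (u₁ := A) (v₁ := k + A) (w₁ := c * A) v) j
  have hg₂ (v : Fin 3 → ℂ) (j : Fin 3) :=
    congrFun (grad_line (u₁ := B) (v₁ := 1 + B) (w₁ := c * B) v) j
  simp only [grad] at hg₁ hg₂
  have hC₀ (v : Fin 3 → ℂ) : eval v (pderiv 0 (conic a)) =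
      2 * a 0 * v 0 + a 1 * v 1 + a 3 * v 2 := by
    simp [conic, pderiv_X, Derivation.leibniz, Derivation.leibniz_pow]
    ring
  have hC₁ (v : Fin 3 → ℂ) : eval v (pderiv 1 (conic a)) =
      a 1 * v 0 + 2 * a 2 * v 1 + a 4 * v 2 := by
    simp [conic, pderiv_X, Derivation.leibniz, Derivation.leibniz_pow]
    ring
  ext1 <;> refine MvPolynomial.funext fun v => ?_
  · simp only [logForm, Param.form, T, map_add, map_sub, map_neg, map_mul, map_pow, hC₀, hg₁, hg₂,
      eval_line, eval_C, eval_X, map_ofNat, Matrix.cons_val_zero]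
    simp only [conic, map_add, map_mul, map_pow, eval_C, eval_X, h4, h5, h6]
    field_simp
    linear_combination 2 * v 1 * (v 1 ^ 2 * h3 + v 1 * (v 0 + v 1 + c * v 2) * h2 +
      (v 0 + v 1 + c * v 2) ^ 2 * h1)
  · simp only [logForm, Param.form, T, map_add, map_sub, map_mul, map_pow, hC₁, hg₁, hg₂,
      eval_line, eval_C, eval_X, map_ofNat, Matrix.cons_val_one, Matrix.cons_val_zero]
    simp only [conic, map_add, map_mul, map_pow, eval_C, eval_X, h4, h5, h6]
    field_simp
    linear_combination 2 * (-v 0 - c * v 2) * (v 1 ^ 2 * h3 + v 1 * (v 0 + v 1 + c * v 2) * h2 +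
      (v 0 + v 1 + c * v 2) ^ 2 * h1)

theorem line_mul_line_eq_linePair (t : Param) {A B : ℂ} (hq : t.q = A + t.k * B)
    (hr : t.r = A * B) :
    line A (t.k + A) (t.c * A) * line B (1 + B) (t.c * B) = t.linePair := by
  refine MvPolynomial.funext fun v => ?_
  simp only [linePair, T, map_add, map_mul, map_pow, eval_line, eval_C, eval_X, hq, hr]
  ring

/-- The assertions about a general member of the family. -/
theorem exists_conic_and_lines {t : Param} (h : generic t.toFun ≠ 0) :
    ∃ a : Fin 6 → ℂ, a ≠ 0 ∧
      (∀ b : Fin 6 → ℂ, t.conicMatrix.mulVec b = 0 ↔ ∃ s : ℂ, b = s • a) ∧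
      IsCurve 2 (conic a) ∧ IsSmoothCurve (conic a) ∧ IsIntegralCurve t.form (conic a) ∧
      ∃ L₁ L₂ : Poly, IsCurve 1 L₁ ∧ IsCurve 1 L₂ ∧ L₁ * L₂ = t.linePair ∧
        LinearIndependent ℂ ![L₁, L₂] ∧ IsIntegralCurve t.form L₁ ∧ IsIntegralCurve t.form L₂ ∧
        DarbouxIntegrableWith t.form ![conic a, L₁, L₂] := by
  rw [generic] at h
  have hconic := right_ne_zero_of_mul h
  have hβ := right_ne_zero_of_mul (left_ne_zero_of_mul h)
  have hdisc := right_ne_zero_of_mul (left_ne_zero_of_mul (left_ne_zero_of_mul h))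
  have hck := left_ne_zero_of_mul (left_ne_zero_of_mul (left_ne_zero_of_mul h))
  have hc : t.c ≠ 0 := left_ne_zero_of_mul hck
  have hk : t.k ≠ 0 := right_ne_zero_of_mul hck
  change t.q ^ 2 - 4 * t.k * t.r ≠ 0 at hdisc
  have hsol : t.conicSol 3 - 2 * t.c * t.conicSol 0 = blockDet t.toFun := by
    show blockDet t.toFun + 2 * t.c * coeff₀ t.toFun - 2 * t.c * coeff₀ t.toFun = _
    ring
  have hlc := t.conic_eq_lineConic (a := t.conicSol) rfl rfl
  have hsm : IsSmoothCurve (conic t.conicSol) := by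
    rw [hlc, hsol]
    refine isSmoothCurve_lineConic (by norm_num) (mul_ne_zero hβ hc) ?_
    have e : (4 * (blockDet t.toFun * t.c) * (t.conicSol 1 - 2 * t.conicSol 0) +
        2 * -blockDet t.toFun * blockDet t.toFun) ^ 2 -
        4 * (4 * (blockDet t.toFun * t.c) * (t.conicSol 0 - t.conicSol 1 + t.conicSol 2) +
          (-blockDet t.toFun) ^ 2) *
          (4 * (blockDet t.toFun * t.c) * t.conicSol 0 + blockDet t.toFun ^ 2) =
        blockDet t.toFun ^ 2 * conicDisc t.toFun := by
      show (4 * (blockDet t.toFun * t.c) * (coeff₁ t.toFun - 2 * coeff₀ t.toFun) +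
        2 * -blockDet t.toFun * blockDet t.toFun) ^ 2 -
        4 * (4 * (blockDet t.toFun * t.c) * (coeff₀ t.toFun - coeff₁ t.toFun + coeff₂ t.toFun) +
          (-blockDet t.toFun) ^ 2) *
          (4 * (blockDet t.toFun * t.c) * coeff₀ t.toFun + blockDet t.toFun ^ 2) = _
      rw [conicDisc, show t.toFun 0 = t.c from rfl]
      ring
    rw [e]
    exact mul_ne_zero (pow_ne_zero 2 hβ) hconic
  have hcurve : IsCurve 2 (conic t.conicSol) := by
    refine ⟨two_pos, hsm.ne_zero, ?_⟩
    rw [hlc]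
    exact isHomogeneous_lineConic (isHomogeneous_line ..) (isHomogeneous_line ..) ..
  obtain ⟨w, hw⟩ := IsAlgClosed.exists_pow_nat_eq (t.q ^ 2 - 4 * t.k * t.r) two_pos
  have hw0 : w ≠ 0 := by
    rintro rfl
    exact hdisc (by rw [← hw]; ring)
  obtain ⟨A, hA⟩ : ∃ A, A = (t.q + w) / 2 := ⟨_, rfl⟩
  obtain ⟨B, hB⟩ : ∃ B, B = (t.q - w) / (2 * t.k) := ⟨_, rfl⟩
  have hkB : t.k * B = (t.q - w) / 2 := by rw [hB]; field_simp
  have hq : t.q = A + t.k * B := by rw [hkB, hA]; ring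
  have hr : t.r = A * B := by
    apply mul_left_cancel₀ hk
    rw [mul_left_comm, hkB, hA]
    linear_combination hw / 4
  have hAB : A - t.k * B = w := by rw [hkB, hA]; ring
  have hm : t.m = (A + t.k * B - (t.q - 2 * t.m) / w * (A - t.k * B)) / 2 := by
    rw [hAB, ← hq]
    field_simp
    ring
  have hd : A * (1 + B) - B * (t.k + A) ≠ 0 := by
    rw [show A * (1 + B) - B * (t.k + A) = w by linear_combination hAB]
    exact hw0
  have hd' : B * (t.k + A) - A * (1 + B) ≠ 0 := fun h => hd (by linear_combination -h)
  have hL₁ : IsCurve 1 (line A (t.k + A) (t.c * A)) := isCurve_line hd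
  have hL₂ : IsCurve 1 (line B (1 + B) (t.c * B)) := isCurve_line hd'
  have hform := t.form_eq_logForm t.mulVec_conicSol (by rwa [hsol]) hq hr hm
  have hdar := darbouxIntegrableWith_logForm (1 / (t.conicSol 3 - 2 * t.c * t.conicSol 0))
    ((-1 - (t.q - 2 * t.m) / w) / (t.conicSol 3 - 2 * t.c * t.conicSol 0))
    ((-1 + (t.q - 2 * t.m) / w) / (t.conicSol 3 - 2 * t.c * t.conicSol 0)) _ _ _ hcurve hL₁ hL₂
  rw [← hform] at hdar
  refine ⟨t.conicSol, ?_, mulVec_eq_zero_iff_exists_smul hβ, hcurve, hsm, hdar.1 0, _, _, hL₁, hL₂,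
    t.line_mul_line_eq_linePair hq hr, ?_, hdar.1 1, hdar.1 2, hdar⟩
  · intro h0
    rw [h0] at hsol
    exact hβ (by rw [← hsol]; simp)
  · rw [LinearIndependent.pair_iff]
    intro s s' hs
    have e0 := congrArg (eval ![1, 0, 0]) hs
    have e1 := congrArg (eval ![0, 1, 0]) hs
    simp only [map_add, smul_eval, eval_line, map_zero, Matrix.cons_val_zero, Matrix.cons_val_one,
      Matrix.cons_val] at e0 e1
    constructor
    · apply mul_left_cancel₀ hd
      linear_combination (1 + B) * e0 - B * e1
    · apply mul_left_cancel₀ hd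
      linear_combination A * e1 - (t.k + A) * e0

end Param

end PlaneForm

end

theorem mainTheorem7 :
    (∃ D : MvPolynomial (Fin 8) ℂ, D ≠ 0 ∧
      ∀ t : PlaneForm.Param, MvPolynomial.eval t.toFun D ≠ 0 →
        ∃ a : Fin 6 → ℂ, a ≠ 0 ∧
          (∀ b : Fin 6 → ℂ, t.conicMatrix.mulVec b = 0 ↔ ∃ s : ℂ, b = s • a) ∧
          PlaneForm.IsCurve 2 (PlaneForm.conic a) ∧
          PlaneForm.IsSmoothCurve (PlaneForm.conic a) ∧
          PlaneForm.IsIntegralCurve t.form (PlaneForm.conic a) ∧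
          ∃ L₁ L₂ : PlaneForm.Poly, PlaneForm.IsCurve 1 L₁ ∧ PlaneForm.IsCurve 1 L₂ ∧
            L₁ * L₂ = t.linePair ∧ LinearIndependent ℂ ![L₁, L₂] ∧
            PlaneForm.IsIntegralCurve t.form L₁ ∧ PlaneForm.IsIntegralCurve t.form L₂ ∧
            PlaneForm.DarbouxIntegrableWith t.form ![PlaneForm.conic a, L₁, L₂]) ∧
    PlaneForm.XCR12 ∩ PlaneForm.centerVariety 3 ⊆
      PlaneForm.zariskiClosure 3 (PlaneForm.XDarboux 3 ![2, 1, 1]) ∧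
    (∀ (t : PlaneForm.Param) (φ : PlaneForm.AffineChange),
      φ.pullback t.form ∈ PlaneForm.poincare 3 → φ.tr ≠ ![-t.c, 0] →
        φ.pullback t.form ∈
          PlaneForm.zariskiClosure 3 (PlaneForm.XDarboux 3 ![2, 1, 1])) := by
  refine ⟨⟨_, PlaneForm.Param.generic_X_ne_zero, fun t ht => ?_⟩,
    PlaneForm.XCR12_inter_centerVariety_subset, fun t φ => PlaneForm.mem_closure_of_tr_ne⟩
  rw [PlaneForm.Param.eval_generic] at ht
  exact PlaneForm.Param.exists_conic_and_lines ht
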